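/- Let $\{L,R\}^*$ be the set of nonempty finite words in the letters $L$ and $R$, and write $|w|$ for the number of letters of $w$. Two words $w,w'$ are equivalent if $w'$ is a cyclic permutation of $w$ or of $w^*$, where $w^*$ is $w$ read backwards with every $L$ replaced by $R$ and vice versa; $[w]$ denotes the equivalence class of $w$ and $|[w]|$ its number of elements. For $N\in\mathbb{N}$ take $2N$ labelled vertices, each with three half-edges in a fixed cyclic order, and let $\Omega_N$ be the set of all partitions of the $6N$ half-edges into pairs, with the uniform probability measure. Each $\omega\in\Omega_N$ defines a cubic ribbon graph $\Gamma(\omega)$ (loops and multiple edges allowed), whose edges are the pairs. A circuit of $\Gamma(\omega)$ is a closed path with at least one edge that visits no vertex twice, regarded as a set of edges (without direction or starting point); loops and double edges are circuits with one and two edges. Traversing a circuit from some starting vertex in one of its two directions, and recording $L$ or $R$ at each vertex according to whether one turns left or right with respect to the cyclic order, gives a word whose equivalence class depends only on the circuit; the circuit is said to carry this class. Let $Z_{N,[w]}(\omega)$ be the number of circuits of $\Gamma(\omega)$ that carry $[w]$. Theorem B. Let $W$ be a finite set of equivalence classes of nonempty words in $L$ and $R$. Then there are independent random variables $Z_{[w]}$,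 $[w]\in W$, where $Z_{[w]}$ is Poisson distributed with mean $\lambda_{[w]}=\frac{|[w]|}{2|w|}$, such that, as $N\to\infty$, the random vectors $(Z_{N,[w]})_{[w]\in W}$ converge to $(Z_{[w]})_{[w]\in W}$ jointly in distribution, and moreover in total variation: $$\lim_{N\to\infty}\ \sup_{A\subseteq\mathbb{N}^W}\left|\mathbb{P}\big((Z_{N,[w]})_{[w]\in W}\in A\big)-\mathbb{P}\big((Z_{[w]})_{[w]\in W}\in A\big)\right|=0.$$ -/

import Mathlib

open MeasureTheory ProbabilityTheory Filter Topology
open scoped NNReal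

namespace RandomRibbon

noncomputable section

/-! ### Words in the letters `L` and `R` -/

/-- The two letters. -/
inductive Letter
  | L
  | R

/-- The other letter. -/
def Letter.swap : Letter → Letter
  | Letter.L => Letter.R
  | Letter.R => Letter.L

/-- `w*`: the word read backwards, with every `L` replaced by `R` and vice versa. -/
def star (w : List Letter) : List Letter := w.reverse.map Letter.swap

/-- A word: a nonempty finite sequence of letters. -/
abbrev Word : Type := {w : List Letter // w ≠ []}

/-- `w'` is equivalent to `w`: it is a cyclic permutation of `w` or of `w*`. -/
def Equivalent (w w' : List Letter) : Prop := w ~r w' ∨ star w ~r w'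

theorem star_star (w : List Letter) : star (star w) = w := by
  have h : Letter.swap ∘ Letter.swap = id := by
    funext a
    cases a <;> rfl
  simp [star, List.map_reverse, h]

theorem length_star (w : List Letter) : (star w).length = w.length := by simp [star]

theorem star_isRotated {w w' : List Letter} (h : w ~r w') : star w ~r star w' :=
  h.reverse.map _

theorem equivalent_refl (w : List Letter) : Equivalent w w := Or.inl (List.IsRotated.refl w)

theorem equivalent_symm {w w' : List Letter} (h : Equivalent w w') : Equivalent w' w := by
  rcases h with h | h
  · exact Or.inl h.symm
  · right
    have h2 := star_isRotated h
    rw [star_star] at h2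
    exact h2.symm

theorem equivalent_trans {u v w : List Letter} (h : Equivalent u v) (h' : Equivalent v w) :
    Equivalent u w := by
  rcases h with h | h <;> rcases h' with h' | h'
  · exact Or.inl (h.trans h')
  · exact Or.inr ((star_isRotated h).trans h')
  · exact Or.inr (h.trans h')
  · left
    have h2 := star_isRotated h
    rw [star_star] at h2
    exact h2.trans h'

theorem Equivalent.length_eq {w w' : List Letter} (h : Equivalent w w') :
    w.length = w'.length := by
  rcases h with h | h
  · exact h.perm.length_eq
  · rw [← length_star w]
    exact h.perm.length_eq

/-- Equivalence of words, as a setoid. -/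
instance wordSetoid : Setoid Word where
  r w w' := Equivalent w.1 w'.1
  iseqv := ⟨fun w => equivalent_refl w.1, equivalent_symm, equivalent_trans⟩

/-- The equivalence classes `[w]` of words. -/
abbrev WordClass : Type := Quotient wordSetoid

/-- `|[w]|`: the number of words in the class. -/
def WordClass.card (c : WordClass) : ℕ := Set.ncard {w : Word | (⟦w⟧ : WordClass) = c}

/-- `|w|`: the common number of letters of the words in the class. -/
def WordClass.length (c : WordClass) : ℕ :=
  Quotient.lift (fun w : Word => w.1.length) (fun _ _ h => Equivalent.length_eq h) c

/-- The mean `|[w]| / (2 |w|)`. -/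
def WordClass.mean (c : WordClass) : ℝ≥0 := (c.card : ℝ≥0) / (2 * (c.length : ℝ≥0))

/-! ### Random cubic ribbon graphs -/

/-- The half-edges of a cubic graph on `2N` labelled vertices: `(v, j)` is the `j`-th half-edge at
the vertex `v`. The cyclic order of the half-edges at `v` is `(v, 0), (v, 1), (v, 2)`. -/
abbrev HalfEdge (N : ℕ) : Type := Fin (2 * N) × Fin 3

/-- The sample space: all partitions of the `6N` half-edges into pairs. Such a partition is a
cubic ribbon graph, with loops and multiple edges allowed, whose edges are the pairs. -/
abbrev Pairing (N : ℕ) : Type :=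
  {P : Finpartition (Finset.univ : Finset (HalfEdge N)) // ∀ e ∈ P.parts, e.card = 2}

/-- Every set of pairings is an event. -/
instance (N : ℕ) : MeasurableSpace (Pairing N) := ⊤

instance (N : ℕ) : MeasurableSingletonClass (Pairing N) := ⟨fun _ => trivial⟩

instance (N : ℕ) : Nonempty (Pairing N) := by
  have hs : 3 * N * 2 + 0 * (2 + 1) = (Finset.univ : Finset (HalfEdge N)).card := by
    simp only [Finset.card_univ, Fintype.card_prod, Fintype.card_fin]
    ring
  refine ⟨⟨(⊥ : Finpartition (Finset.univ : Finset (HalfEdge N))).equitabilise hs, ?_⟩⟩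
  intro e he
  rcases Finpartition.card_eq_of_mem_parts_equitabilise he with h | h
  · exact h
  · exfalso
    have h0 := Finpartition.card_filter_equitabilise_big
      (⊥ : Finpartition (Finset.univ : Finset (HalfEdge N))) hs
    rw [Finset.card_eq_zero, Finset.filter_eq_empty_iff] at h0
    exact h0 he h

/-- The uniform probability measure on the pairings. -/
def uniform (N : ℕ) : Measure (Pairing N) := uniformOn Set.univ

instance (N : ℕ) : IsProbabilityMeasure (uniform N) := by
  unfold uniform
  infer_instance

/-- The half-edge to the left, for someone who arrives at the vertex along `h`; the cyclic order is
counterclockwise. -/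
def HalfEdge.left {N : ℕ} (h : HalfEdge N) : HalfEdge N := (h.1, h.2 - 1)

/-- A circuit with `n ≥ 1` edges in the ribbon graph of `ω`, together with a direction and a start
vertex. The `i`-th vertex is entered along `inn i` and left along `out i`, the vertices are pairwise
distinct, and `out i` is paired with `inn (i + 1)`, where indices are modulo `n`. For `n = 1` this is
a loop, for `n = 2` a double edge. -/
structure DirectedCircuit {N : ℕ} (ω : Pairing N) (n : ℕ) [NeZero n] where
  inn : Fin n → HalfEdge N
  out : Fin n → HalfEdge N
  same_vertex : ∀ i, (out i).1 = (inn i).1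
  out_ne_inn : ∀ i, out i ≠ inn i
  vertex_injective : Function.Injective fun i => (inn i).1
  edge_mem : ∀ i, ({out i, inn (i + 1)} : Finset (HalfEdge N)) ∈ ω.1.parts

namespace DirectedCircuit

variable {N : ℕ} {ω : Pairing N} {n : ℕ} [NeZero n]

/-- The underlying undirected circuit, as a set of edges. -/
def edges (γ : DirectedCircuit ω n) : Finset (Finset (HalfEdge N)) :=
  Finset.univ.image fun i => {γ.out i, γ.inn (i + 1)}

/-- The letter picked up at the `i`-th vertex: `L` for a left turn, `R` for a right turn. -/
def letter (γ : DirectedCircuit ω n) (i : Fin n) : Letter :=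
  if γ.out i = (γ.inn i).left then Letter.L else Letter.R

/-- The word picked up along the directed circuit. -/
def word (γ : DirectedCircuit ω n) : Word :=
  ⟨List.ofFn γ.letter, fun h => NeZero.ne n (List.ofFn_eq_nil_iff.mp h)⟩

end DirectedCircuit

/-- `C` is (the edge set of) a circuit of the ribbon graph of `ω` which carries the class `c`. -/
def CircuitCarries {N : ℕ} (ω : Pairing N) (C : Finset (Finset (HalfEdge N)))
    (c : WordClass) : Prop :=
  ∃ (n : ℕ) (_ : NeZero n) (γ : DirectedCircuit ω n), γ.edges = C ∧ ⟦γ.word⟧ = c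

/-- `Z_{N,[w]}`: the number of circuits that carry the class. -/
def Z (N : ℕ) (c : WordClass) (ω : Pairing N) : ℕ :=
  Set.ncard {C : Finset (Finset (HalfEdge N)) | CircuitCarries ω C c}

/-! ### Distance of laws -/

/-- The sup-distance, or total variation distance, of two random variables `X` and `Y` with values
in a countable set: the supremum over all `A` of `|P(X ∈ A) - P'(Y ∈ A)|`. -/
def supDist {Ω Ω' E : Type*} [MeasurableSpace Ω] [MeasurableSpace Ω'] (P : Measure Ω)
    (P' : Measure Ω') (X : Ω → E) (Y : Ω' → E) : ℝ :=
  ⨆ A : Set E, |P.real (X ⁻¹' A) - P'.real (Y ⁻¹' A)|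

end

end RandomRibbon

/-!
Why the counts become independent Poisson variables.

Independent Poisson variables `(Z_c)` with means `λ_c` are characterized by the recursion
`(k_c + 1) P(Z = k + e_c) = λ_c P(Z = k)` for all vectors `k` and all classes `c`, where `e_c` is
the unit vector. The circuit counts satisfy this recursion up to an error that vanishes as `N → ∞`
(`abs_recursion_le`), and by Markov's inequality they do not lose mass at infinity
(`one_sub_le_sum_countProb`). This forces the point probabilities to converge
(`tendsto_of_recursion`), and convergence of point probabilities to a probability law is convergence
in total variation (`abs_measureReal_sub_le`). No higher moments are needed.

The recursion comes from a switching coupling. Summing over the possible circuits `C` of class `c`,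
`(k_c + 1) P(Z = k + e_c) = ∑_C P(C ⊆ ω) P(Z(ω) = k + e_c | C ⊆ ω)`. For a set `C` of disjoint pairs
of half-edges, `exists_switching` provides a map `S` that turns a uniform pairing `ω` into a uniform
pairing conditioned to contain `C`: for each pair `{a, b}` in `C`, one exchanges `b` with the partner
of `a`. It remains to see that `Z(S ω) = Z(ω) + e_c` with high probability, uniformly in `C`
(`sum_abs_Z_switch_le`).

* Circuits disjoint from `C` that are present in `ω` survive the switching. Hence the mean number of
  those that are created is a difference of two explicit expectations, which tends to `0`
  (`conditioningGap`).
* Circuits other than `C` that meet `C` are rare, before and after the switching: a circuit that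
  meets `C` and differs from it has more edges outside `C` than vertices outside `C`
  (`RootedCircuit.outside_lt_card_sdiff`). Each such vertex contributes a factor `N` to the number of
  circuits, and each such edge a factor `1 / N` to the probability.

The means are found by counting rooted circuits: there are `|[w]| (2N)(2N - 1)⋯(2N - n + 1) 3ⁿ` of
them for a class of length `n` (`card_rootedCircuits`), each is contained in a random pairing with
probability `1 / ((6N - 1)(6N - 3)⋯(6N - 2n + 1))`, and every circuit has exactly `2n` rooted versions
(`RootedCircuit.card_edges_eq`), so that the mean tends to `|[w]| / (2n)`.
-/

namespace RandomRibbon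

/-! ### Uniform pairings and switchings -/

section Matching

open Finset

variable {N : ℕ}

theorem exists_partner (ω : Pairing N) (a : HalfEdge N) :
    ∃ b, a ≠ b ∧ ({a, b} : Finset (HalfEdge N)) ∈ ω.1.parts := by
  obtain ⟨t, ht, hat⟩ := ω.1.exists_mem (mem_univ a)
  obtain ⟨x, y, hxy, rfl⟩ := Finset.card_eq_two.mp (ω.2 t ht)
  rw [mem_insert, mem_singleton] at hat
  rcases hat with rfl | rfl
  · exact ⟨y, hxy, ht⟩
  · exact ⟨x, hxy.symm, by rwa [pair_comm]⟩

/-- The half-edge with which `ω` pairs the half-edge `a`. -/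
noncomputable def partner (ω : Pairing N) (a : HalfEdge N) : HalfEdge N :=
  (exists_partner ω a).choose

theorem partner_ne (ω : Pairing N) (a : HalfEdge N) : a ≠ partner ω a :=
  (exists_partner ω a).choose_spec.1

theorem pair_partner_mem (ω : Pairing N) (a : HalfEdge N) :
    ({a, partner ω a} : Finset (HalfEdge N)) ∈ ω.1.parts :=
  (exists_partner ω a).choose_spec.2

theorem ne_of_pair_mem {ω : Pairing N} {a b : HalfEdge N}
    (h : ({a, b} : Finset (HalfEdge N)) ∈ ω.1.parts) : a ≠ b := by
  rintro rfl
  simpa using ω.2 _ h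

theorem pair_eq_pair_left {α : Type*} [DecidableEq α] {a b c : α} (hab : a ≠ b)
    (h : ({a, b} : Finset α) = {a, c}) : b = c := by
  have : b ∈ ({a, c} : Finset α) := h ▸ by simp
  simpa [hab.symm] using this

theorem pair_mem_iff {ω : Pairing N} {a b : HalfEdge N} :
    ({a, b} : Finset (HalfEdge N)) ∈ ω.1.parts ↔ partner ω a = b := by
  constructor
  · intro h
    exact (pair_eq_pair_left (ne_of_pair_mem h)
      (ω.1.eq_of_mem_parts h (pair_partner_mem ω a) (by simp : a ∈ _) (by simp))).symm
  · rintro rfl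
    exact pair_partner_mem ω a

/-- Relabelling the half-edges of a pairing by a permutation. -/
def permute (τ : Equiv.Perm (HalfEdge N)) (ω : Pairing N) : Pairing N :=
  ⟨Finpartition.ofExistsUnique (ω.1.parts.map τ.finsetCongr.toEmbedding)
    (fun _ _ => subset_univ _)
    (by
      intro a _
      obtain ⟨t, ⟨ht, hat⟩, hu⟩ := ω.1.existsUnique_mem (mem_univ (τ.symm a))
      refine ⟨τ.finsetCongr t, ⟨mem_map_of_mem _ ht, ?_⟩, ?_⟩
      · simpa [Finset.mem_map_equiv] using hat
      · rintro s ⟨hs, has⟩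
        obtain ⟨u, hu', rfl⟩ := Finset.mem_map.mp hs
        have : u = t := hu u ⟨hu', by simpa [Finset.mem_map_equiv] using has⟩
        rw [this]
        rfl)
    (by
      intro h
      obtain ⟨s, hs, h⟩ := Finset.mem_map.mp h
      have h2 : s = ∅ := by simpa using h
      exact ω.1.ne_empty hs h2),
    by
      intro e he
      obtain ⟨s, hs, rfl⟩ := Finset.mem_map.mp he
      simpa using ω.2 s hs⟩

theorem permute_parts (τ : Equiv.Perm (HalfEdge N)) (ω : Pairing N) :
    (permute τ ω).1.parts = ω.1.parts.map τ.finsetCongr.toEmbedding := rfl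

theorem permute_symm (τ : Equiv.Perm (HalfEdge N)) (ω : Pairing N) :
    permute τ.symm (permute τ ω) = ω := by
  apply Subtype.ext
  apply Finpartition.ext
  rw [permute_parts, permute_parts, Finset.map_map]
  ext e
  simp [Finset.map_map]

theorem permute_swap_self (x y : HalfEdge N) (ω : Pairing N) :
    permute (Equiv.swap x y) (permute (Equiv.swap x y) ω) = ω := by
  conv_rhs => rw [← permute_symm (Equiv.swap x y) ω]
  rw [Equiv.symm_swap]

theorem pair_mem_permute {τ : Equiv.Perm (HalfEdge N)} {ω : Pairing N} {a b : HalfEdge N}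
    (h : ({a, b} : Finset (HalfEdge N)) ∈ ω.1.parts) :
    ({τ a, τ b} : Finset (HalfEdge N)) ∈ (permute τ ω).1.parts := by
  rw [permute_parts, Finset.mem_map]
  exact ⟨_, h, by simp⟩

/-- A swap of half-edges keeps the edges that contain neither of the two. -/
theorem mem_permute_swap {ω : Pairing N} {x y : HalfEdge N} {e : Finset (HalfEdge N)}
    (he : e ∈ ω.1.parts) (hx : x ∉ e) (hy : y ∉ e) :
    e ∈ (permute (Equiv.swap x y) ω).1.parts := by
  obtain ⟨a, b, -, rfl⟩ := Finset.card_eq_two.mp (ω.2 e he)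
  simp only [mem_insert, mem_singleton, not_or] at hx hy
  have h := pair_mem_permute (τ := Equiv.swap x y) he
  rwa [Equiv.swap_apply_of_ne_of_ne (Ne.symm hx.1) (Ne.symm hy.1),
    Equiv.swap_apply_of_ne_of_ne (Ne.symm hx.2) (Ne.symm hy.2)] at h

/-- The pairings that contain a given set of edges. -/
noncomputable def containing (C : Finset (Finset (HalfEdge N))) : Finset (Pairing N) :=
  {ω | C ⊆ ω.1.parts}

theorem mem_containing {C : Finset (Finset (HalfEdge N))} {ω : Pairing N} :
    ω ∈ containing C ↔ C ⊆ ω.1.parts := by simp [containing]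

/-- A partial pairing: a set of pairwise disjoint pairs of half-edges. -/
structure IsPartialPairing (C : Finset (Finset (HalfEdge N))) : Prop where
  card_eq_two : ∀ e ∈ C, e.card = 2
  disjoint : (C : Set (Finset (HalfEdge N))).PairwiseDisjoint id

theorem isPartialPairing_of_subset {C : Finset (Finset (HalfEdge N))} {ω : Pairing N}
    (h : C ⊆ ω.1.parts) : IsPartialPairing C :=
  ⟨fun e he => ω.2 e (h he), fun _ ha _ hb hab => ω.1.disjoint (h ha) (h hb) hab⟩

theorem IsPartialPairing.card_biUnion {C : Finset (Finset (HalfEdge N))}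
    (h : IsPartialPairing C) : (C.biUnion id).card = 2 * C.card := by
  rw [Finset.card_biUnion h.disjoint, mul_comm]
  exact Finset.sum_const_nat h.card_eq_two

theorem IsPartialPairing.mono {C D : Finset (Finset (HalfEdge N))} (h : IsPartialPairing C)
    (hD : D ⊆ C) : IsPartialPairing D :=
  ⟨fun e he => h.card_eq_two e (hD he), fun _ ha _ hb hab => h.disjoint (hD ha) (hD hb) hab⟩

/-- Averaging over pairings that contain `C`, one may instead prescribe one more edge `{a, b}`, by
swapping `b` with the partner of `a`. -/
theorem sum_switch {C : Finset (Finset (HalfEdge N))} (hC : IsPartialPairing C)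
    {a b : HalfEdge N} (hab : a ≠ b) (ha : a ∉ C.biUnion id) (hb : b ∉ C.biUnion id)
    (g : Pairing N → ℝ) :
    ∑ ω ∈ containing C, g (permute (Equiv.swap b (partner ω a)) ω) =
      (6 * N - 1 - 2 * C.card : ℝ) * ∑ ω ∈ containing (insert {a, b} C), g ω := by
  -- Split by the partner `c` of `a`. The swap of `b` and `c` is a bijection from the pairings that
  -- contain `C` and `{a, c}` to those that contain `C` and `{a, b}`.
  set T : Finset (HalfEdge N) := univ \ insert a (C.biUnion id) with hT
  have hmaps : ∀ ω ∈ containing C, partner ω a ∈ T := by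
    intro ω hω
    rw [mem_containing] at hω
    rw [hT, Finset.mem_sdiff, mem_insert, not_or]
    refine ⟨mem_univ _, (partner_ne ω a).symm, fun h => ha ?_⟩
    obtain ⟨e, he, hae⟩ := mem_biUnion.mp h
    have : e = {a, partner ω a} :=
      ω.1.eq_of_mem_parts (hω he) (pair_partner_mem ω a) hae (by simp)
    exact mem_biUnion.mpr ⟨e, he, by simp [this]⟩
  have hinner : ∀ c ∈ T, ∑ ω ∈ (containing C).filter (fun ω => partner ω a = c),
      g (permute (Equiv.swap b (partner ω a)) ω) = ∑ ω ∈ containing (insert {a, b} C), g ω := by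
    intro c hc
    rw [hT, Finset.mem_sdiff, mem_insert, not_or] at hc
    obtain ⟨-, hca, hcC⟩ := hc
    have hkeep : ∀ ω : Pairing N, C ⊆ ω.1.parts → C ⊆ (permute (Equiv.swap b c) ω).1.parts := by
      intro ω hω e he
      exact mem_permute_swap (hω he) (fun h => hb (mem_biUnion.mpr ⟨e, he, h⟩))
        (fun h => hcC (mem_biUnion.mpr ⟨e, he, h⟩))
    refine Finset.sum_nbij' (fun ω => permute (Equiv.swap b c) ω)
      (fun ω => permute (Equiv.swap b c) ω) ?_ ?_ ?_ ?_ ?_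
    · intro ω hω
      rw [mem_filter, mem_containing] at hω
      rw [mem_containing, insert_subset_iff]
      refine ⟨?_, hkeep ω hω.1⟩
      have := pair_mem_permute (τ := Equiv.swap b c) (pair_mem_iff.mpr hω.2)
      rwa [Equiv.swap_apply_of_ne_of_ne hab (Ne.symm hca), Equiv.swap_apply_right] at this
    · intro ω hω
      rw [mem_containing, insert_subset_iff] at hω
      rw [mem_filter, mem_containing]
      refine ⟨hkeep ω hω.2, ?_⟩
      have := pair_mem_permute (τ := Equiv.swap b c) hω.1
      rwa [Equiv.swap_apply_of_ne_of_ne hab (Ne.symm hca), Equiv.swap_apply_left,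
        pair_mem_iff] at this
    · intro ω _
      exact permute_swap_self _ _ _
    · intro ω _
      exact permute_swap_self _ _ _
    · intro ω hω
      rw [mem_filter] at hω
      rw [hω.2]
  rw [← Finset.sum_fiberwise_of_maps_to hmaps, Finset.sum_congr rfl hinner, Finset.sum_const,
    nsmul_eq_mul]
  congr 1
  have hcard : T.card + (2 * C.card + 1) = 6 * N := by
    rw [← hC.card_biUnion, ← card_insert_of_notMem ha, hT, ← Finset.compl_eq_univ_sdiff,
      Finset.card_compl_add_card]
    simp only [Fintype.card_prod, Fintype.card_fin]
    ring
  have hcard' : (T.card : ℝ) + (2 * C.card + 1) = 6 * N := by exact_mod_cast hcard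
  linarith

/-- `(6N-1)(6N-3)⋯(6N-2k+1)`, the inverse of the probability that a random pairing contains `k`
given disjoint pairs. It is defined in `ℝ`, so nothing is truncated, but it is this inverse only
as long as its factors are positive. -/
noncomputable def pairingFactor (N k : ℕ) : ℝ := ∏ j ∈ Finset.range k, (6 * N - 1 - 2 * j : ℝ)

/-- The switching coupling: a map on pairings that sends the uniform pairing to the
uniform pairing conditioned to contain `C`, and keeps every edge disjoint from the edges of `C`. -/
theorem exists_switching {C : Finset (Finset (HalfEdge N))} (hC : IsPartialPairing C) :
    ∃ S : Pairing N → Pairing N,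
      (∀ g : Pairing N → ℝ,
        ∑ ω, g (S ω) = pairingFactor N C.card * ∑ ω ∈ containing C, g ω) ∧
      ∀ ω, ∀ e ∈ ω.1.parts, Disjoint e (C.biUnion id) → e ∈ (S ω).1.parts := by
  induction C using Finset.induction_on with
  | empty =>
    refine ⟨id, fun g => ?_, fun ω e he _ => he⟩
    simp [pairingFactor, containing]
  | insert e C heC ih =>
    obtain ⟨S, hS, hkeep⟩ := ih (hC.mono (subset_insert _ _))
    obtain ⟨a, b, hab, rfl⟩ := Finset.card_eq_two.mp (hC.card_eq_two e (mem_insert_self _ _))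
    have hdisj : ∀ x ∈ ({a, b} : Finset (HalfEdge N)), x ∉ C.biUnion id := by
      intro x hx hxC
      obtain ⟨f, hf, hxf⟩ := mem_biUnion.mp hxC
      have hne : ({a, b} : Finset (HalfEdge N)) ≠ f := fun h => heC (h ▸ hf)
      have := hC.disjoint (mem_coe.mpr (mem_insert_self _ _))
        (mem_coe.mpr (mem_insert_of_mem hf)) hne
      exact Finset.disjoint_left.mp this hx hxf
    refine ⟨fun ω => permute (Equiv.swap b (partner (S ω) a)) (S ω), fun g => ?_, ?_⟩
    · rw [hS (fun ω => g (permute (Equiv.swap b (partner ω a)) ω)),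
        sum_switch (hC.mono (subset_insert _ _)) hab (hdisj a (by simp)) (hdisj b (by simp)),
        card_insert_of_notMem heC, pairingFactor, pairingFactor, Finset.prod_range_succ]
      ring
    · intro ω f hf hfC
      rw [biUnion_insert, disjoint_union_right] at hfC
      have hfS := hkeep ω f hf hfC.2
      have hfa : a ∉ f := fun h => Finset.disjoint_left.mp hfC.1 h (by simp)
      have hfb : b ∉ f := fun h => Finset.disjoint_left.mp hfC.1 h (by simp)
      refine mem_permute_swap hfS hfb fun h => hfa ?_
      rw [(S ω).1.eq_of_mem_parts hfS (pair_partner_mem (S ω) a) h (by simp)]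
      simp

/-- A partial pairing with `k` edges is contained in a fraction `1 / pairingFactor N k` of all
pairings. -/
theorem card_containing {C : Finset (Finset (HalfEdge N))} (hC : IsPartialPairing C) :
    (Fintype.card (Pairing N) : ℝ) = pairingFactor N C.card * (containing C).card := by
  obtain ⟨S, hS, -⟩ := exists_switching hC
  simpa using hS (fun _ => 1)

end Matching

/-! ### Rooted circuits -/

section Circuits

open Finset
open scoped Fin.NatCast Fin.CommRing

/-- A circuit of length `n` on the half-edges, together with a direction and a start vertex, with no
reference to a pairing: it is a directed circuit of each pairing that contains its edges. -/
@[ext]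
structure RootedCircuit (N n : ℕ) where
  inn : Fin n → HalfEdge N
  out : Fin n → HalfEdge N
  same_vertex : ∀ i, (out i).1 = (inn i).1
  out_ne_inn : ∀ i, out i ≠ inn i
  vertex_injective : Function.Injective fun i => (inn i).1

theorem ofFn_isRotated {n : ℕ} {α : Type*} (f : Fin n → α) (k : Fin n) :
    List.ofFn f ~r List.ofFn fun i => f (i + k) := by
  refine ⟨k.val, List.ext_getElem (by simp) fun i h1 h2 => ?_⟩
  rw [List.getElem_rotate, List.getElem_ofFn, List.getElem_ofFn]
  congr 1
  ext
  simp [Fin.val_add]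

namespace RootedCircuit

variable {N n m : ℕ}

noncomputable instance : Fintype (RootedCircuit N n) :=
  Fintype.ofInjective (fun γ => (γ.inn, γ.out)) fun γ δ h => by
    rw [Prod.mk.injEq] at h
    exact RootedCircuit.ext h.1 h.2

noncomputable instance : DecidableEq (RootedCircuit N n) := Classical.decEq _

variable (γ : RootedCircuit N n)

theorem inn_injective : Function.Injective γ.inn :=
  fun _ _ h => γ.vertex_injective (congrArg Prod.fst h)

theorem out_injective : Function.Injective γ.out := fun _ _ h =>
  γ.vertex_injective (by
    have := congrArg Prod.fst h
    rwa [γ.same_vertex, γ.same_vertex] at this)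

theorem out_ne_inn' (i j : Fin n) : γ.out i ≠ γ.inn j := by
  intro h
  have hij : i = j := γ.vertex_injective (by
    have := congrArg Prod.fst h
    rwa [γ.same_vertex] at this)
  subst hij
  exact γ.out_ne_inn i h

variable [NeZero n] [NeZero m]

/-- The `i`-th edge, which joins the `i`-th vertex to the next one. -/
def edge (i : Fin n) : Finset (HalfEdge N) := {γ.out i, γ.inn (i + 1)}

/-- The underlying set of edges. -/
def edges : Finset (Finset (HalfEdge N)) := univ.image γ.edge

/-- The letter picked up at the `i`-th vertex. -/
def letter (i : Fin n) : Letter := if γ.out i = (γ.inn i).left then Letter.L else Letter.R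

/-- The word picked up along the circuit. -/
def word : Word :=
  ⟨List.ofFn γ.letter, fun h => NeZero.ne n (List.ofFn_eq_nil_iff.mp h)⟩

theorem edge_mem (i : Fin n) : γ.edge i ∈ γ.edges := mem_image_of_mem _ (mem_univ i)

theorem out_mem_edge {i j : Fin n} : γ.out i ∈ γ.edge j ↔ i = j := by
  rw [edge, mem_insert, mem_singleton]
  exact ⟨fun h => h.elim (fun h => γ.out_injective h) fun h => absurd h (γ.out_ne_inn' _ _),
    fun h => Or.inl (h ▸ rfl)⟩

theorem inn_mem_edge {i j : Fin n} : γ.inn i ∈ γ.edge j ↔ i = j + 1 := by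
  rw [edge, mem_insert, mem_singleton]
  exact ⟨fun h => h.elim (fun h => absurd h.symm (γ.out_ne_inn' _ _)) fun h => γ.inn_injective h,
    fun h => Or.inr (h ▸ rfl)⟩

theorem edge_injective : Function.Injective γ.edge := fun _ _ h =>
  γ.out_mem_edge.mp (h ▸ γ.out_mem_edge.mpr rfl)

theorem card_edges : γ.edges.card = n := by
  rw [edges, card_image_of_injective _ γ.edge_injective, card_univ, Fintype.card_fin]

theorem isPartialPairing_edges : IsPartialPairing γ.edges := by
  constructor
  · intro e he
    obtain ⟨i, -, rfl⟩ := Finset.mem_image.mp he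
    exact card_pair (γ.out_ne_inn' _ _)
  · intro e he f hf hef
    obtain ⟨i, -, rfl⟩ := Finset.mem_image.mp (mem_coe.mp he)
    obtain ⟨j, -, rfl⟩ := Finset.mem_image.mp (mem_coe.mp hf)
    refine Finset.disjoint_left.mpr fun x hx hxj => hef ?_
    simp only [id, edge, mem_insert, mem_singleton] at hx
    rcases hx with rfl | rfl
    · rw [γ.out_mem_edge.mp hxj]
    · rw [add_right_cancel (γ.inn_mem_edge.mp hxj)]

theorem mem_biUnion_edges {x : HalfEdge N} :
    x ∈ γ.edges.biUnion id ↔ ∃ i, x = γ.inn i ∨ x = γ.out i := by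
  simp only [edges, mem_biUnion, Finset.mem_image, mem_univ, true_and, id, exists_exists_eq_and]
  constructor
  · rintro ⟨i, hi⟩
    rw [edge, mem_insert, mem_singleton] at hi
    rcases hi with h | h
    · exact ⟨i, Or.inr h⟩
    · exact ⟨i + 1, Or.inl h⟩
  · rintro ⟨i, rfl | rfl⟩
    · exact ⟨i - 1, γ.inn_mem_edge.mpr (sub_add_cancel i 1).symm⟩
    · exact ⟨i, γ.out_mem_edge.mpr rfl⟩

/-- The same circuit with another start vertex. -/
def rotate (k : Fin n) : RootedCircuit N n where
  inn i := γ.inn (i + k)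
  out i := γ.out (i + k)
  same_vertex _ := γ.same_vertex _
  out_ne_inn _ := γ.out_ne_inn _
  vertex_injective _ _ h := add_right_cancel (γ.vertex_injective h)

/-- The same circuit traversed in the opposite direction. -/
def reverse : RootedCircuit N n where
  inn i := γ.out (-i)
  out i := γ.inn (-i)
  same_vertex _ := (γ.same_vertex _).symm
  out_ne_inn _ := (γ.out_ne_inn _).symm
  vertex_injective _ _ h := by
    simp only [γ.same_vertex] at h
    exact neg_injective (γ.vertex_injective h)

theorem edges_rotate (k : Fin n) : (γ.rotate k).edges = γ.edges := by
  have h : (γ.rotate k).edge = γ.edge ∘ Equiv.addRight k := by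
    funext i
    simp only [edge, rotate, Function.comp, Equiv.coe_addRight]
    rw [add_right_comm]
  rw [edges, edges, h, ← Finset.image_image, Finset.image_univ_equiv]

theorem edges_reverse : γ.reverse.edges = γ.edges := by
  have h : γ.reverse.edge = γ.edge ∘ ((Equiv.addRight 1).trans (Equiv.neg (Fin n))) := by
    funext i
    simp only [edge, reverse, Function.comp, Equiv.trans_apply, Equiv.coe_addRight,
      Equiv.neg_apply]
    rw [pair_comm, neg_add, neg_add_cancel_right]
  rw [edges, edges, h, ← Finset.image_image, Finset.image_univ_equiv]

theorem out_eq_of_inn_eq {γ : RootedCircuit N n} {δ : RootedCircuit N m}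
    (h : δ.edges ⊆ γ.edges) {i : Fin m} {a : Fin n} (hi : δ.inn i = γ.inn a) :
    δ.out i = γ.out a := by
  have hmem : δ.out i ∈ γ.edges.biUnion id :=
    biUnion_subset_biUnion_of_subset_left _ h (δ.mem_biUnion_edges.mpr ⟨i, Or.inr rfl⟩)
  obtain ⟨b, hb⟩ := γ.mem_biUnion_edges.mp hmem
  have hv : (δ.out i).1 = (γ.inn a).1 := by rw [δ.same_vertex, hi]
  rcases hb with hb | hb
  · have : b = a := γ.vertex_injective (by rw [hb] at hv; exact hv)
    exact absurd (by rw [hb, this, hi]) (δ.out_ne_inn i)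
  · have : b = a := γ.vertex_injective (by rw [hb, γ.same_vertex] at hv; exact hv)
    rw [hb, this]

theorem inn_succ_eq_of_out_eq {γ : RootedCircuit N n} {δ : RootedCircuit N m}
    (h : δ.edges ⊆ γ.edges) {i : Fin m} {a : Fin n} (hi : δ.out i = γ.out a) :
    δ.inn (i + 1) = γ.inn (a + 1) := by
  obtain ⟨b, -, hb⟩ := Finset.mem_image.mp (h (δ.edge_mem i))
  have hab : a = b := γ.out_mem_edge.mp (by rw [hb, ← hi]; exact δ.out_mem_edge.mpr rfl)
  subst hab
  rw [edge, edge, ← hi] at hb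
  exact (pair_eq_pair_left (by rw [hi]; exact γ.out_ne_inn' _ _) hb).symm

/-- A circuit inside the edges of `γ` follows `γ` once it enters a vertex along the same half-edge. -/
theorem follow {γ : RootedCircuit N n} {δ : RootedCircuit N m} (h : δ.edges ⊆ γ.edges)
    {k : Fin n} (hk : δ.inn 0 = γ.inn k) (j : ℕ) :
    δ.inn (j : Fin m) = γ.inn ((j : Fin n) + k) ∧ δ.out (j : Fin m) = γ.out ((j : Fin n) + k) := by
  suffices hinn : δ.inn (j : Fin m) = γ.inn ((j : Fin n) + k) from ⟨hinn, out_eq_of_inn_eq h hinn⟩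
  induction j with
  | zero => simpa using hk
  | succ j ih =>
    have := inn_succ_eq_of_out_eq h (out_eq_of_inn_eq h ih)
    rw [Nat.cast_succ, Nat.cast_succ, this, add_right_comm]

/-- Each of the two circuits closes up when the other one does, so the lengths divide each other. -/
theorem length_eq_of_inn_eq {γ : RootedCircuit N n} {δ : RootedCircuit N m}
    (h : δ.edges ⊆ γ.edges) {k : Fin n} (hk : δ.inn 0 = γ.inn k) : m = n := by
  apply Nat.dvd_antisymm
  · have := (follow h hk n).1
    rw [Fin.natCast_self, zero_add, ← hk] at this
    exact (Fin.natCast_eq_zero).mp (δ.inn_injective this)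
  · have := (follow h hk m).1
    rw [Fin.natCast_self, hk] at this
    have := γ.inn_injective this
    exact (Fin.natCast_eq_zero).mp (left_eq_add.mp (by rw [add_comm] at this; exact this))

theorem eq_rotate_of_inn_eq {γ δ : RootedCircuit N n} (h : δ.edges ⊆ γ.edges) {k : Fin n}
    (hk : δ.inn 0 = γ.inn k) : δ = γ.rotate k := by
  ext1
  · funext i
    have := (follow h hk i.val).1
    rwa [Fin.cast_val_eq_self] at this
  · funext i
    have := (follow h hk i.val).2
    rwa [Fin.cast_val_eq_self] at this

theorem inn_zero_eq {γ : RootedCircuit N n} {δ : RootedCircuit N m} (h : δ.edges ⊆ γ.edges) :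
    ∃ k, δ.inn 0 = γ.inn k ∨ δ.inn 0 = γ.reverse.inn k := by
  have hmem : δ.inn 0 ∈ γ.edges.biUnion id :=
    biUnion_subset_biUnion_of_subset_left _ h (δ.mem_biUnion_edges.mpr ⟨0, Or.inl rfl⟩)
  obtain ⟨k, hk | hk⟩ := γ.mem_biUnion_edges.mp hmem
  · exact ⟨k, Or.inl hk⟩
  · exact ⟨-k, Or.inr (by rw [hk, reverse]; simp)⟩

theorem length_eq_of_edges_subset {γ : RootedCircuit N n} {δ : RootedCircuit N m}
    (h : δ.edges ⊆ γ.edges) : m = n := by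
  obtain ⟨k, hk | hk⟩ := inn_zero_eq h
  · exact length_eq_of_inn_eq h hk
  · exact length_eq_of_inn_eq (h.trans γ.edges_reverse.symm.subset) hk

theorem edges_eq_of_subset {γ : RootedCircuit N n} {δ : RootedCircuit N m}
    (h : δ.edges ⊆ γ.edges) : δ.edges = γ.edges :=
  eq_of_subset_of_card_le h (by rw [card_edges, card_edges, length_eq_of_edges_subset h])

theorem eq_rotate_or_reverse {γ δ : RootedCircuit N n} (h : δ.edges = γ.edges) :
    ∃ k, δ = γ.rotate k ∨ δ = γ.reverse.rotate k := by
  obtain ⟨k, hk | hk⟩ := inn_zero_eq h.subset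
  · exact ⟨k, Or.inl (eq_rotate_of_inn_eq h.subset hk)⟩
  · exact ⟨k, Or.inr (eq_rotate_of_inn_eq (h.trans γ.edges_reverse.symm).subset hk)⟩

/-- A circuit with `n` edges has `2n` rooted versions. -/
theorem card_edges_eq (γ : RootedCircuit N n) :
    (univ.filter fun δ : RootedCircuit N n => δ.edges = γ.edges).card = 2 * n := by
  have hcard : (univ : Finset (Bool × Fin n)).card = 2 * n := by simp
  rw [← hcard]
  symm
  refine card_bij (fun p _ => if p.1 then γ.reverse.rotate p.2 else γ.rotate p.2) ?_ ?_ ?_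
  · rintro ⟨b, k⟩ -
    rw [mem_filter]
    refine ⟨mem_univ _, ?_⟩
    cases b <;> simp [edges_rotate, edges_reverse]
  · rintro ⟨b, k⟩ - ⟨c, l⟩ - h
    have h0 := congrArg (fun δ : RootedCircuit N n => δ.inn 0) h
    cases b <;> cases c <;> simp [rotate, reverse] at h0
    · rw [γ.inn_injective h0]
    · exact absurd h0.symm (γ.out_ne_inn' _ _)
    · exact absurd h0 (γ.out_ne_inn' _ _)
    · rw [neg_injective (γ.out_injective h0)]
  · intro δ hδ
    rw [mem_filter] at hδ
    obtain ⟨k, hk | hk⟩ := eq_rotate_or_reverse hδ.2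
    · exact ⟨(false, k), mem_univ _, by simp [hk]⟩
    · exact ⟨(true, k), mem_univ _, by simp [hk]⟩

theorem star_ofFn (f : Fin n → Letter) :
    star (List.ofFn f) = List.ofFn fun i => (f (-(i + 1))).swap := by
  refine List.ext_getElem (by simp [star]) fun i h1 h2 => ?_
  have hi : i < n := by simpa using h2
  simp only [star, List.getElem_map, List.getElem_reverse, List.getElem_ofFn, List.length_ofFn]
  congr 2
  rw [eq_neg_iff_add_eq_zero]
  ext
  simp only [Fin.val_add, Fin.val_one', Fin.val_zero]
  simp only [Nat.add_mod_mod]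
  rw [show n - 1 - i + (i + 1) = n by omega, Nat.mod_self]

/-- Of two half-edges at a cubic vertex, exactly one is to the left of the other. -/
theorem left_eq_iff_of_ne {x y : HalfEdge N} (hv : x.1 = y.1) (hxy : x ≠ y) :
    y = x.left ↔ x ≠ y.left := by
  obtain ⟨v, i⟩ := x
  obtain ⟨w, j⟩ := y
  simp only at hv
  subst hv
  simp only [HalfEdge.left, ne_eq, Prod.mk.injEq, true_and] at hxy ⊢
  revert i j
  decide

theorem letter_reverse {n : ℕ} (γ : RootedCircuit N n) (i : Fin n) :
    γ.reverse.letter i = (γ.letter (-i)).swap := by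
  have h := left_eq_iff_of_ne (γ.same_vertex (-i)) (γ.out_ne_inn (-i))
  change (if γ.inn (-i) = (γ.out (-i)).left then Letter.L else Letter.R) =
    (if γ.out (-i) = (γ.inn (-i)).left then Letter.L else Letter.R).swap
  by_cases h1 : γ.out (-i) = (γ.inn (-i)).left
  · rw [if_pos h1, if_neg fun h2 => h.mp h2 h1, Letter.swap]
  · rw [if_neg h1, if_pos (h.mpr h1), Letter.swap]

theorem word_rotate (k : Fin n) : (⟦(γ.rotate k).word⟧ : WordClass) = ⟦γ.word⟧ :=
  Quotient.sound (equivalent_symm (Or.inl (ofFn_isRotated γ.letter k)))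

theorem word_reverse : (⟦γ.reverse.word⟧ : WordClass) = ⟦γ.word⟧ := by
  refine Quotient.sound (equivalent_symm (Or.inr ?_))
  change star (List.ofFn γ.letter) ~r List.ofFn γ.reverse.letter
  rw [star_ofFn]
  have h := ofFn_isRotated γ.reverse.letter 1
  simp only [letter_reverse] at h ⊢
  exact h.symm

/-- The class carried by a circuit depends only on its set of edges. -/
theorem word_eq_of_edges_eq {γ δ : RootedCircuit N n} (h : δ.edges = γ.edges) :
    (⟦δ.word⟧ : WordClass) = ⟦γ.word⟧ := by
  obtain ⟨k, rfl | rfl⟩ := eq_rotate_or_reverse h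
  · exact γ.word_rotate k
  · rw [word_rotate, word_reverse]

end RootedCircuit

end Circuits

/-! ### Counting circuits that carry a class -/

section Classes

open Finset

theorem WordClass.length_mk (w : Word) : WordClass.length ⟦w⟧ = w.1.length := rfl

instance (c : WordClass) : NeZero c.length := ⟨by
  induction c using Quotient.inductionOn with
  | h w => exact fun h => w.2 (List.length_eq_zero_iff.mp h)⟩

/-- The rooted circuits that carry a class. -/
noncomputable def rootedCircuits (N : ℕ) (c : WordClass) : Finset (RootedCircuit N c.length) :=
  open Classical in {γ | (⟦γ.word⟧ : WordClass) = c}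

theorem mem_rootedCircuits {N : ℕ} {c : WordClass} {γ : RootedCircuit N c.length} :
    γ ∈ rootedCircuits N c ↔ (⟦γ.word⟧ : WordClass) = c := by
  simp [rootedCircuits]

/-- The edge sets of the circuits that carry a class, in any pairing. -/
noncomputable def circuitSets (N : ℕ) (c : WordClass) : Finset (Finset (Finset (HalfEdge N))) :=
  (rootedCircuits N c).image fun γ => γ.edges

theorem circuitCarries_iff {N : ℕ} {ω : Pairing N} {C : Finset (Finset (HalfEdge N))}
    {c : WordClass} : CircuitCarries ω C c ↔ C ∈ circuitSets N c ∧ C ⊆ ω.1.parts := by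
  constructor
  · rintro ⟨n, _, γ, rfl, hc⟩
    have hn : c.length = n := by
      rw [← hc, WordClass.length_mk]
      exact List.length_ofFn
    subst hn
    refine ⟨Finset.mem_image.mpr ⟨⟨γ.inn, γ.out, γ.same_vertex, γ.out_ne_inn, γ.vertex_injective⟩,
      mem_rootedCircuits.mpr hc, rfl⟩, fun e he => ?_⟩
    obtain ⟨i, -, rfl⟩ := Finset.mem_image.mp he
    exact γ.edge_mem i
  · rintro ⟨hC, hsub⟩
    obtain ⟨γ, hγ, rfl⟩ := Finset.mem_image.mp hC
    exact ⟨c.length, inferInstance, ⟨γ.inn, γ.out, γ.same_vertex, γ.out_ne_inn,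
      γ.vertex_injective, fun i => hsub (γ.edge_mem i)⟩, rfl, mem_rootedCircuits.mp hγ⟩

theorem Z_eq_card (N : ℕ) (c : WordClass) (ω : Pairing N) :
    Z N c ω = ((circuitSets N c).filter fun C => C ⊆ ω.1.parts).card := by
  rw [Z, ← Set.ncard_coe_finset]
  congr 1
  ext C
  simp [circuitCarries_iff]

theorem Z_eq_sum (N : ℕ) (c : WordClass) (ω : Pairing N) :
    (Z N c ω : ℝ) = ∑ C ∈ circuitSets N c, if C ⊆ ω.1.parts then 1 else 0 := by
  rw [Z_eq_card, Finset.card_filter]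
  push_cast
  rfl

/-- A circuit carries only one class. -/
theorem eq_of_mem_circuitSets {N : ℕ} {c d : WordClass} {C : Finset (Finset (HalfEdge N))}
    (hc : C ∈ circuitSets N c) (hd : C ∈ circuitSets N d) : c = d := by
  obtain ⟨γ, hγ, rfl⟩ := Finset.mem_image.mp hc
  obtain ⟨δ, hδ, h⟩ := Finset.mem_image.mp hd
  rw [mem_rootedCircuits] at hγ hδ
  have aux : ∀ {n m : ℕ} [NeZero n] [NeZero m] (γ : RootedCircuit N n) (δ : RootedCircuit N m),
      δ.edges = γ.edges → (⟦δ.word⟧ : WordClass) = ⟦γ.word⟧ := by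
    intro n m _ _ γ δ h
    obtain rfl := RootedCircuit.length_eq_of_edges_subset h.subset
    exact RootedCircuit.word_eq_of_edges_eq h
  rw [← hγ, ← hδ]
  exact (aux γ δ h).symm

/-- Every circuit has `2n` rooted versions, so that sums over circuits are sums over rooted
circuits, divided by `2n`. -/
theorem sum_circuitSets (N : ℕ) (c : WordClass) (F : Finset (Finset (HalfEdge N)) → ℝ) :
    ∑ γ ∈ rootedCircuits N c, F γ.edges = 2 * c.length * ∑ C ∈ circuitSets N c, F C := by
  rw [Finset.sum_comp, Finset.mul_sum]
  refine Finset.sum_congr rfl fun C hC => ?_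
  obtain ⟨γ, hγ, rfl⟩ := Finset.mem_image.mp hC
  have : (rootedCircuits N c).filter (fun δ => δ.edges = γ.edges) =
      univ.filter fun δ => δ.edges = γ.edges := by
    ext δ
    simp only [mem_filter, mem_univ, true_and, and_iff_right_iff_imp]
    intro h
    rw [mem_rootedCircuits] at hγ ⊢
    rw [RootedCircuit.word_eq_of_edges_eq h, hγ]
  rw [this, RootedCircuit.card_edges_eq, nsmul_eq_mul]
  push_cast
  rfl

theorem sum_circuitSets_le (N : ℕ) (c : WordClass) {F : Finset (Finset (HalfEdge N)) → ℝ}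
    (hF : ∀ C, 0 ≤ F C) :
    ∑ C ∈ circuitSets N c, F C ≤ ∑ γ : RootedCircuit N c.length, F γ.edges := by
  have h1 : ∑ C ∈ circuitSets N c, F C ≤ 2 * c.length * ∑ C ∈ circuitSets N c, F C := by
    have hn : (1 : ℝ) ≤ c.length := by exact_mod_cast NeZero.one_le
    have : 0 ≤ ∑ C ∈ circuitSets N c, F C := Finset.sum_nonneg fun C _ => hF C
    nlinarith
  rw [← sum_circuitSets] at h1
  exact h1.trans (Finset.sum_le_sum_of_subset_of_nonneg (subset_univ _) fun _ _ _ => hF _)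

local instance : DecidableEq Letter
  | Letter.L, Letter.L => isTrue rfl
  | Letter.L, Letter.R => isFalse fun h => Letter.noConfusion h
  | Letter.R, Letter.L => isFalse fun h => Letter.noConfusion h
  | Letter.R, Letter.R => isTrue rfl

local instance : Fintype Letter := ⟨{Letter.L, Letter.R}, fun a => by cases a <;> simp⟩

/-- A rooted circuit is given by its vertices, the half-edges along which they are entered, and the
turns. -/
noncomputable def rootedCircuitEquiv (N n : ℕ) :
    RootedCircuit N n ≃ (Fin n ↪ Fin (2 * N)) × (Fin n → Fin 3) × (Fin n → Letter) where
  toFun γ := (⟨fun i => (γ.inn i).1, γ.vertex_injective⟩, fun i => (γ.inn i).2, γ.letter)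
  invFun p :=
    { inn := fun i => (p.1 i, p.2.1 i)
      out := fun i => (p.1 i, match p.2.2 i with
        | Letter.L => p.2.1 i - 1
        | Letter.R => p.2.1 i + 1)
      same_vertex := fun _ => rfl
      out_ne_inn := fun i h => by
        have h2 := congrArg Prod.snd h
        simp only at h2
        generalize p.2.1 i = j at h2
        cases h3 : p.2.2 i <;> simp [h3] at h2
      vertex_injective := p.1.injective }
  left_inv γ := by
    ext1
    · rfl
    · funext i
      have hv := γ.same_vertex i
      have hne := γ.out_ne_inn i
      refine Prod.ext hv.symm ?_
      simp only [RootedCircuit.letter]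
      generalize γ.out i = x at *
      generalize γ.inn i = y at *
      obtain ⟨v, j⟩ := x
      obtain ⟨w, k⟩ := y
      simp only at hv
      subst hv
      simp only [HalfEdge.left, ne_eq, Prod.mk.injEq, true_and] at hne ⊢
      revert j k
      decide
  right_inv p := by
    refine Prod.ext rfl (Prod.ext rfl ?_)
    funext i
    simp only [RootedCircuit.letter, HalfEdge.left, Prod.mk.injEq, true_and]
    generalize p.2.1 i = j
    cases p.2.2 i
    · simp
    · revert j
      decide

theorem card_ofFn_eq_card (c : WordClass) :
    Set.ncard {f : Fin c.length → Letter |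
      (⟦⟨List.ofFn f, fun h => NeZero.ne _ (List.ofFn_eq_nil_iff.mp h)⟩⟧ : WordClass) = c} =
      c.card := by
  rw [WordClass.card]
  refine Set.ncard_congr (fun f _ => ⟨List.ofFn f, fun h => NeZero.ne _ (List.ofFn_eq_nil_iff.mp h)⟩)
    (fun f hf => hf) (fun f g _ _ h => List.ofFn_injective (Subtype.ext_iff.mp h)) ?_
  rintro w hw
  have hlen : w.1.length = c.length := by
    rw [← WordClass.length_mk]
    exact congrArg _ hw
  have hfn : List.ofFn (fun i : Fin c.length => w.1.get (Fin.cast hlen.symm i)) = w.1 := by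
    refine List.ext_getElem (by simp [hlen]) fun i h1 h2 => by simp
  have hw' : (⟨List.ofFn (fun i : Fin c.length => w.1.get (Fin.cast hlen.symm i)),
      fun h => NeZero.ne _ (List.ofFn_eq_nil_iff.mp h)⟩ : Word) = w := Subtype.ext hfn
  exact ⟨_, (by rw [Set.mem_ofPred_eq, hw']; exact hw), hw'⟩

theorem card_rootedCircuits (N : ℕ) (c : WordClass) :
    (rootedCircuits N c).card = c.card * ((2 * N).descFactorial c.length * 3 ^ c.length) := by
  classical
  let T : Finset (Fin c.length → Letter) := {f |
      (⟦⟨List.ofFn f, fun h => NeZero.ne _ (List.ofFn_eq_nil_iff.mp h)⟩⟧ : WordClass) = c}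
  have hT : T.card = c.card := by
    rw [← card_ofFn_eq_card, ← Set.ncard_coe_finset]
    congr 1
    ext f
    simp [T]
  have h : (rootedCircuits N c).card =
      ((univ : Finset (Fin c.length ↪ Fin (2 * N))) ×ˢ
        (univ : Finset (Fin c.length → Fin 3)) ×ˢ T).card := by
    refine Finset.card_equiv (rootedCircuitEquiv N c.length) fun γ => ?_
    rw [mem_rootedCircuits]
    simp only [mem_product, mem_univ, true_and, T, mem_filter]
    rfl
  rw [h, Finset.card_product, Finset.card_product, hT]
  simp only [card_univ, Fintype.card_embedding_eq, Fintype.card_fin, Fintype.card_fun]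
  ring

end Classes

/-! ### The effect of a switching on the circuit counts -/

section Estimates

open Finset

variable {N n m : ℕ}

theorem pairingFactor_add (N a k : ℕ) : pairingFactor N (a + k) =
    pairingFactor N a * ∏ j ∈ Finset.range k, (6 * N - 1 - 2 * (a + j) : ℝ) := by
  rw [pairingFactor, pairingFactor, Finset.prod_range_add]
  push_cast
  rfl

theorem pow_le_prod_factor {N a k : ℕ} (h : a + k ≤ N) :
    (N : ℝ) ^ k ≤ ∏ j ∈ Finset.range k, (6 * N - 1 - 2 * (a + j) : ℝ) := by
  rw [← Finset.card_range k, ← Finset.prod_const, Finset.card_range]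
  refine Finset.prod_le_prod (fun _ _ => Nat.cast_nonneg _) fun j hj => ?_
  have h1 : a + j + 1 ≤ N := by
    have := Finset.mem_range.mp hj
    omega
  have h2 : (a : ℝ) + j + 1 ≤ N := by exact_mod_cast h1
  have h3 : (0 : ℝ) ≤ a + j := by positivity
  linarith

theorem pow_le_pairingFactor {N k : ℕ} (h : k ≤ N) : (N : ℝ) ^ k ≤ pairingFactor N k := by
  have := pow_le_prod_factor (a := 0) (k := k) (N := N) (by omega)
  simpa [pairingFactor] using this

theorem pairingFactor_pos {N k : ℕ} (h : k ≤ N) (hN : 0 < N) : 0 < pairingFactor N k :=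
  lt_of_lt_of_le (by positivity) (pow_le_pairingFactor h)

theorem card_containing_le {D : Finset (Finset (HalfEdge N))} (hD : 0 < pairingFactor N D.card) :
    ((containing D).card : ℝ) ≤ Fintype.card (Pairing N) / pairingFactor N D.card := by
  rcases (containing D).eq_empty_or_nonempty with h | ⟨ω, hω⟩
  · rw [h]
    simp only [card_empty, Nat.cast_zero]
    positivity
  · rw [card_containing (isPartialPairing_of_subset (mem_containing.mp hω)),
      mul_div_cancel_left₀ _ hD.ne']

theorem card_containing_eq {D : Finset (Finset (HalfEdge N))} (hD : IsPartialPairing D) :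
    ((containing D).card : ℝ) = Fintype.card (Pairing N) / pairingFactor N D.card := by
  have h := card_containing hD
  have hK : (Fintype.card (Pairing N) : ℝ) ≠ 0 := by
    exact_mod_cast Fintype.card_ne_zero
  have hQ : pairingFactor N D.card ≠ 0 := fun h0 => hK (by rw [h, h0, zero_mul])
  rw [h, mul_div_cancel_left₀ _ hQ]

/-- The probability that a random pairing contains both `n` given edges and `m` given disjoint edges,
conditioned on the former, minus the probability that it contains the latter. -/
noncomputable def conditioningGap (N n m : ℕ) : ℝ :=
  pairingFactor N n / pairingFactor N (n + m) - 1 / pairingFactor N m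

theorem conditioningGap_nonneg (h : n + m ≤ N) (hN : 0 < N) : 0 ≤ conditioningGap N n m := by
  have hn := pairingFactor_pos (k := n) (by omega : n ≤ N) hN
  have hpos : 0 < ∏ j ∈ Finset.range m, (6 * N - 1 - 2 * (n + j) : ℝ) :=
    lt_of_lt_of_le (by positivity) (pow_le_prod_factor h)
  rw [conditioningGap, sub_nonneg, pairingFactor_add, div_mul_eq_div_div, div_self hn.ne']
  refine one_div_le_one_div_of_le hpos ?_
  refine Finset.prod_le_prod (fun j hj => ?_) fun j _ => ?_
  · have h1 : n + j + 1 ≤ N := by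
      have := Finset.mem_range.mp hj
      omega
    have h2 : (n : ℝ) + j + 1 ≤ N := by exact_mod_cast h1
    have h3 : (0 : ℝ) ≤ n + j := by positivity
    linarith
  · have : (0 : ℝ) ≤ n := by positivity
    linarith

namespace RootedCircuit

/-- The number of vertices of a circuit outside a given set of vertices. -/
def outside (V : Finset (Fin (2 * N))) (δ : RootedCircuit N m) : ℕ :=
  (univ.filter fun i => (δ.inn i).1 ∉ V).card

/-- The sum over all circuits of length `m`, with a weight `x` for every vertex outside `V`. A circuit
of length `m` is a sequence of `m` vertices with two half-edges each, so the sum is at most the `m`-th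
power of the weighted number of vertices with two half-edges. With `x = 1 / N` the bound does not
depend on `N`: each vertex outside `V` can be chosen in at most `2N` ways. -/
theorem sum_pow_outside_le (V : Finset (Fin (2 * N))) (m : ℕ) {x : ℝ} (hx : 0 ≤ x) :
    ∑ δ : RootedCircuit N m, x ^ outside V δ ≤ (9 * (V.card + 2 * N * x)) ^ m := by
  let f : Fin (2 * N) × Fin 3 × Fin 3 → ℝ := fun a => if a.1 ∈ V then 1 else x
  have hf : ∀ a, 0 ≤ f a := fun a => by
    simp only [f]
    split_ifs <;> positivity
  let φ : RootedCircuit N m → Fin m → Fin (2 * N) × Fin 3 × Fin 3 :=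
    fun δ i => ((δ.inn i).1, (δ.inn i).2, (δ.out i).2)
  have hφ : Function.Injective φ := by
    intro δ ε h
    have h' : ∀ i, φ δ i = φ ε i := fun i => congrFun h i
    simp only [φ, Prod.mk.injEq] at h'
    have hinn : δ.inn = ε.inn := funext fun i => Prod.ext (h' i).1 (h' i).2.1
    refine RootedCircuit.ext hinn (funext fun i => Prod.ext ?_ (h' i).2.2)
    rw [δ.same_vertex, ε.same_vertex, hinn]
  have hprod : ∀ δ : RootedCircuit N m, x ^ outside V δ = ∏ i, f (φ δ i) := by
    intro δ
    simp only [f, φ, outside]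
    rw [Finset.prod_ite]
    simp
  have hsum : ∑ a, f a ≤ 9 * (V.card + 2 * N * x) := by
    have h9 : ∑ a, f a = 9 * ∑ v : Fin (2 * N), if v ∈ V then 1 else x := by
      rw [Fintype.sum_prod_type, Finset.mul_sum]
      refine Finset.sum_congr rfl fun v _ => ?_
      change ∑ _ : Fin 3 × Fin 3, (if v ∈ V then 1 else x) = _
      simp only [Finset.sum_const, card_univ, Fintype.card_prod, Fintype.card_fin, nsmul_eq_mul]
      norm_num
    rw [h9, Finset.sum_ite]
    simp only [Finset.sum_const, nsmul_eq_mul, Finset.filter_mem_eq_inter, Finset.univ_inter]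
    have h1 : ((univ.filter fun a => a ∉ V).card : ℝ) ≤ 2 * N := by
      have := Finset.card_le_univ (univ.filter fun a => a ∉ V)
      rw [Fintype.card_fin] at this
      exact_mod_cast this
    rw [mul_one]
    nlinarith [mul_le_mul_of_nonneg_right h1 hx]
  calc ∑ δ : RootedCircuit N m, x ^ outside V δ = ∑ δ, ∏ i, f (φ δ i) :=
        Finset.sum_congr rfl fun δ _ => hprod δ
    _ = ∑ p ∈ univ.image φ, ∏ i, f (p i) := by
        rw [Finset.sum_image fun _ _ _ _ h => hφ h]
    _ ≤ ∑ p : Fin m → Fin (2 * N) × Fin 3 × Fin 3, ∏ i, f (p i) :=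
        Finset.sum_le_sum_of_subset_of_nonneg (subset_univ _)
          fun _ _ _ => Finset.prod_nonneg fun _ _ => hf _
    _ = (∑ a, f a) ^ m := (Fintype.sum_pow f m).symm
    _ ≤ _ := pow_le_pow_left₀ (Finset.sum_nonneg fun a _ => hf a) hsum m

theorem card_le (N m : ℕ) : (Fintype.card (RootedCircuit N m) : ℝ) ≤ (18 * N) ^ m := by
  have h := sum_pow_outside_le (N := N) ∅ m (zero_le_one (α := ℝ))
  simp only [one_pow, Finset.sum_const, card_univ, nsmul_eq_mul, mul_one, card_empty,
    Nat.cast_zero, zero_add] at h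
  convert h using 2
  ring

theorem outside_lt {V : Finset (Fin (2 * N))} {δ : RootedCircuit N m}
    (hmeet : ∃ i, (δ.inn i).1 ∈ V) : outside V δ < m := by
  obtain ⟨i, hi⟩ := hmeet
  have : (univ.filter fun i => (δ.inn i).1 ∉ V).card < (univ : Finset (Fin m)).card :=
    card_lt_card (Finset.ssubset_univ_iff.mpr fun h => by
      have : i ∈ univ.filter fun i => (δ.inn i).1 ∉ V := by
        rw [h]
        exact mem_univ i
      simp only [mem_filter, mem_univ, true_and] at this
      exact this hi)
  rwa [card_univ, Fintype.card_fin] at this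

/-- The vertices of a circuit. -/
def vertices (γ : RootedCircuit N n) : Finset (Fin (2 * N)) := univ.image fun i => (γ.inn i).1

theorem card_vertices_le (γ : RootedCircuit N n) : γ.vertices.card ≤ n :=
  card_image_le.trans (by simp)

variable [NeZero n] [NeZero m]

theorem fst_mem_vertices {γ : RootedCircuit N n} {x : HalfEdge N}
    (h : x ∈ γ.edges.biUnion id) : x.1 ∈ γ.vertices := by
  obtain ⟨i, rfl | rfl⟩ := γ.mem_biUnion_edges.mp h
  · exact mem_image_of_mem _ (mem_univ i)
  · rw [γ.same_vertex]
    exact mem_image_of_mem _ (mem_univ i)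

/-- A circuit that meets another circuit but differs from it has more new edges than new vertices. -/
theorem outside_lt_card_sdiff {γ : RootedCircuit N n} {δ : RootedCircuit N m}
    (hne : δ.edges ≠ γ.edges) (hmeet : ∃ i, (δ.inn i).1 ∈ γ.vertices) :
    outside γ.vertices δ < (δ.edges \ γ.edges).card := by
  have hcard : (δ.edges \ γ.edges).card = (univ.filter fun i => δ.edge i ∉ γ.edges).card := by
    rw [← card_image_of_injective _ δ.edge_injective]
    congr 1
    ext e
    simp only [edges, Finset.mem_sdiff, Finset.mem_image, mem_filter, mem_univ, true_and]
    constructor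
    · rintro ⟨⟨i, rfl⟩, h⟩
      exact ⟨i, h, rfl⟩
    · rintro ⟨i, h, rfl⟩
      exact ⟨⟨i, rfl⟩, h⟩
  have hsub : (univ.filter fun i => (δ.inn i).1 ∉ γ.vertices) ⊆
      univ.filter fun i => δ.edge i ∉ γ.edges := by
    intro i hi
    simp only [mem_filter, mem_univ, true_and] at hi ⊢
    intro h
    apply hi
    rw [← δ.same_vertex]
    exact fst_mem_vertices (mem_biUnion.mpr ⟨_, h, δ.out_mem_edge.mpr rfl⟩)
  rw [hcard, outside]
  refine card_lt_card (Finset.ssubset_iff_subset_ne.mpr ⟨hsub, fun heq => hne ?_⟩)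
  -- Otherwise every edge of `δ` that starts on `γ` is an edge of `γ`, so `δ` never leaves `γ`.
  have hstep : ∀ i, (δ.inn i).1 ∈ γ.vertices → δ.edge i ∈ γ.edges := by
    intro i hi
    by_contra h
    have : i ∈ univ.filter fun i => (δ.inn i).1 ∉ γ.vertices := by
      rw [heq]
      simpa using h
    simp only [mem_filter, mem_univ, true_and] at this
    exact this hi
  obtain ⟨i₀, hi₀⟩ := hmeet
  open scoped Fin.NatCast Fin.CommRing in
  have hall : ∀ j : ℕ, (δ.inn (i₀ + (j : Fin m))).1 ∈ γ.vertices := by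
    intro j
    induction j with
    | zero => simpa using hi₀
    | succ j ih =>
      rw [Nat.cast_succ, ← add_assoc]
      exact fst_mem_vertices (mem_biUnion.mpr ⟨_, hstep _ ih, δ.inn_mem_edge.mpr rfl⟩)
  refine edges_eq_of_subset fun e he => ?_
  obtain ⟨i, -, rfl⟩ := Finset.mem_image.mp he
  apply hstep
  open scoped Fin.NatCast Fin.CommRing in
  have h := hall (i - i₀).val
  rwa [Fin.cast_val_eq_self, add_sub_cancel] at h

theorem disjoint_biUnion_edges {γ : RootedCircuit N n} {δ : RootedCircuit N m}
    (h : ¬ ∃ i, (δ.inn i).1 ∈ γ.vertices) :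
    Disjoint (δ.edges.biUnion id) (γ.edges.biUnion id) := by
  refine Finset.disjoint_left.mpr fun x hx hxγ => h ?_
  have hv := fst_mem_vertices hxγ
  obtain ⟨i, rfl | rfl⟩ := δ.mem_biUnion_edges.mp hx
  · exact ⟨i, hv⟩
  · exact ⟨i, by rwa [← δ.same_vertex]⟩

theorem isPartialPairing_union {γ : RootedCircuit N n} {δ : RootedCircuit N m}
    (h : Disjoint (δ.edges.biUnion id) (γ.edges.biUnion id)) :
    IsPartialPairing (γ.edges ∪ δ.edges) := by
  have hc : ∀ e ∈ γ.edges, ∀ f ∈ δ.edges, Disjoint e f := fun e he f hf =>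
    (Finset.disjoint_of_subset_left (subset_biUnion_of_mem id hf)
      (Finset.disjoint_of_subset_right (subset_biUnion_of_mem id he) h)).symm
  constructor
  · intro e he
    rcases Finset.mem_union.mp he with he | he
    · exact γ.isPartialPairing_edges.card_eq_two e he
    · exact δ.isPartialPairing_edges.card_eq_two e he
  · intro e he f hf hef
    rcases Finset.mem_union.mp (mem_coe.mp he) with he | he <;>
      rcases Finset.mem_union.mp (mem_coe.mp hf) with hf | hf
    · exact γ.isPartialPairing_edges.disjoint he hf hef
    · exact hc e he f hf
    · exact (hc f hf e he).symm
    · exact δ.isPartialPairing_edges.disjoint he hf hef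

theorem disjoint_edges {γ : RootedCircuit N n} {δ : RootedCircuit N m}
    (h : Disjoint (δ.edges.biUnion id) (γ.edges.biUnion id)) : Disjoint γ.edges δ.edges := by
  refine Finset.disjoint_left.mpr fun e he he' => ?_
  obtain ⟨i, -, rfl⟩ := Finset.mem_image.mp he
  have hi := γ.out_mem_edge.mpr (rfl : i = i)
  exact Finset.disjoint_left.mp h (mem_biUnion.mpr ⟨_, he', hi⟩) (mem_biUnion.mpr ⟨_, he, hi⟩)

end RootedCircuit

/-- The indicator function of the pairings that contain `D`. -/
noncomputable def ind (D : Finset (Finset (HalfEdge N))) (ω : Pairing N) : ℝ :=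
  if D ⊆ ω.1.parts then 1 else 0

theorem sum_ind (D : Finset (Finset (HalfEdge N))) : ∑ ω, ind D ω = (containing D).card := by
  simp [ind, containing]

theorem sum_containing_ind (C D : Finset (Finset (HalfEdge N))) :
    ∑ ω ∈ containing C, ind D ω = (containing (C ∪ D)).card := by
  rw [containing, Finset.sum_filter, containing, Finset.card_filter]
  push_cast
  refine Finset.sum_congr rfl fun ω _ => ?_
  simp only [ind, union_subset_iff]
  split_ifs <;> simp_all

theorem ind_nonneg (D : Finset (Finset (HalfEdge N))) (ω : Pairing N) : 0 ≤ ind D ω := by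
  rw [ind]
  split_ifs <;> norm_num

variable [NeZero n] [NeZero m]

open RootedCircuit in
/-- The expected error at a single circuit `δ` when the edges of `γ` are switched in. -/
theorem sum_abs_ind_switch_le {γ : RootedCircuit N n} {S : Pairing N → Pairing N}
    (hS : ∀ g : Pairing N → ℝ,
        ∑ ω, g (S ω) = pairingFactor N γ.edges.card * ∑ ω ∈ containing γ.edges, g ω)
    (hkeep : ∀ ω, ∀ e ∈ ω.1.parts, Disjoint e (γ.edges.biUnion id) → e ∈ (S ω).1.parts)
    (hN : n + m ≤ N) (δ : RootedCircuit N m) :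
    ∑ ω, |ind δ.edges (S ω) - ind δ.edges ω - if δ.edges = γ.edges then 1 else 0| ≤
      Fintype.card (Pairing N) *
        (2 * ((1 / N : ℝ) * (1 / N) ^ outside γ.vertices δ) + conditioningGap N n m) := by
  have hn1 : 1 ≤ n := NeZero.one_le
  have hm1 : 1 ≤ m := NeZero.one_le
  have hN0 : 0 < N := by omega
  have hN1 : (1 : ℝ) ≤ N := by exact_mod_cast hN0
  have hgap := conditioningGap_nonneg hN hN0
  have hx0 : (0 : ℝ) ≤ 1 / N := by positivity
  have hx1 : (1 / N : ℝ) ≤ 1 := by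
    rw [div_le_one (by linarith)]
    exact hN1
  rw [γ.card_edges] at hS
  have hQn := pairingFactor_pos (N := N) (k := n) (by omega) hN0
  set K : ℝ := (Fintype.card (Pairing N) : ℝ) with hK
  have hK0 : 0 ≤ K := Nat.cast_nonneg _
  have hS' : ∑ ω, ind δ.edges (S ω) =
      pairingFactor N n * (containing (γ.edges ∪ δ.edges)).card := by
    rw [hS (ind δ.edges), sum_containing_ind]
  by_cases hmeet : ∃ i, (δ.inn i).1 ∈ γ.vertices
  -- If `δ` meets `γ`, both terms are small in mean, apart from `δ = γ` after the switching.
  · have hp : ∑ ω, ind δ.edges ω ≤ K * ((1 / N : ℝ) * (1 / N) ^ outside γ.vertices δ) := by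
      have hQ : 0 < pairingFactor N δ.edges.card := by
        rw [δ.card_edges]
        exact pairingFactor_pos (by omega) hN0
      rw [sum_ind, ← pow_succ']
      refine (card_containing_le hQ).trans ?_
      rw [δ.card_edges, div_eq_mul_one_div]
      refine mul_le_mul_of_nonneg_left ?_ hK0
      calc 1 / pairingFactor N m ≤ 1 / (N : ℝ) ^ m :=
            one_div_le_one_div_of_le (by positivity) (pow_le_pairingFactor (by omega))
        _ = (1 / N : ℝ) ^ m := by rw [one_div_pow]
        _ ≤ _ := pow_le_pow_of_le_one hx0 hx1 (outside_lt hmeet)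
    have habs : ∑ ω, |ind δ.edges (S ω) - ind δ.edges ω - if δ.edges = γ.edges then 1 else 0| ≤
        ∑ ω, |ind δ.edges (S ω) - if δ.edges = γ.edges then 1 else 0| + ∑ ω, ind δ.edges ω := by
      rw [← Finset.sum_add_distrib]
      refine Finset.sum_le_sum fun ω _ => ?_
      rw [sub_right_comm]
      refine (abs_sub _ _).trans (add_le_add_right ?_ _)
      exact (abs_of_nonneg (ind_nonneg _ _)).le
    have hq : ∑ ω, |ind δ.edges (S ω) - if δ.edges = γ.edges then 1 else 0| ≤
        K * ((1 / N : ℝ) * (1 / N) ^ outside γ.vertices δ) := by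
      by_cases heq : δ.edges = γ.edges
      · have : ∑ ω, |ind δ.edges (S ω) - if δ.edges = γ.edges then 1 else 0| = 0 := by
          rw [hS (fun ω => |ind δ.edges ω - if δ.edges = γ.edges then 1 else 0|)]
          refine mul_eq_zero_of_right _ (Finset.sum_eq_zero fun ω hω => ?_)
          rw [if_pos heq, ind, heq, if_pos (mem_containing.mp hω)]
          simp
        rw [this]
        positivity
      · have hcard : (γ.edges ∪ δ.edges).card = n + (δ.edges \ γ.edges).card := by
          rw [← Finset.union_sdiff_self_eq_union, card_union_of_disjoint disjoint_sdiff,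
            γ.card_edges]
        have hle : n + (δ.edges \ γ.edges).card ≤ N := by
          have := card_le_card (Finset.sdiff_subset (s := δ.edges) (t := γ.edges))
          rw [δ.card_edges] at this
          omega
        simp only [if_neg heq, sub_zero]
        simp only [abs_of_nonneg (ind_nonneg _ _)]
        have hQ : 0 < pairingFactor N (γ.edges ∪ δ.edges).card := by
          rw [hcard]
          exact pairingFactor_pos hle hN0
        rw [hS', ← pow_succ']
        refine (mul_le_mul_of_nonneg_left (card_containing_le hQ) hQn.le).trans ?_
        rw [hcard, pairingFactor_add, mul_div_assoc', mul_comm _ (Fintype.card _ : ℝ),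
          mul_div_assoc, div_mul_eq_div_div, div_self hQn.ne']
        refine mul_le_mul_of_nonneg_left ?_ hK0
        calc _ ≤ 1 / (N : ℝ) ^ (δ.edges \ γ.edges).card :=
              one_div_le_one_div_of_le (by positivity) (pow_le_prod_factor hle)
          _ = (1 / N : ℝ) ^ (δ.edges \ γ.edges).card := by rw [one_div_pow]
          _ ≤ _ := pow_le_pow_of_le_one hx0 hx1 (outside_lt_card_sdiff heq hmeet)
    have := mul_nonneg hK0 hgap
    linarith
  -- If `δ` is disjoint from `γ`, the switching does not destroy it, so the absolute value can be
  -- dropped and the mean is a difference of two probabilities.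
  · have hdisj := disjoint_biUnion_edges hmeet
    have hne : δ.edges ≠ γ.edges := by
      intro h
      have := (disjoint_edges hdisj).symm
      rw [h, disjoint_self_iff_empty] at this
      have h2 := γ.card_edges
      rw [this, card_empty] at h2
      omega
    have hmono : ∀ ω, 0 ≤ ind δ.edges (S ω) - ind δ.edges ω := by
      intro ω
      rw [ind, ind, sub_nonneg]
      by_cases h : δ.edges ⊆ ω.1.parts
      · have hSω : δ.edges ⊆ (S ω).1.parts := fun e he => hkeep ω e (h he)
          (Finset.disjoint_of_subset_left (subset_biUnion_of_mem id he) hdisj)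
        rw [if_pos h, if_pos hSω]
      · rw [if_neg h]
        split_ifs <;> norm_num
    simp only [if_neg hne, sub_zero]
    rw [Finset.sum_congr rfl fun ω _ => abs_of_nonneg (hmono ω), Finset.sum_sub_distrib, hS',
      sum_ind, card_containing_eq (isPartialPairing_union hdisj),
      card_containing_eq δ.isPartialPairing_edges, card_union_of_disjoint (disjoint_edges hdisj),
      γ.card_edges, δ.card_edges]
    have : pairingFactor N n * (K / pairingFactor N (n + m)) - K / pairingFactor N m =
        K * conditioningGap N n m := by
      rw [conditioningGap]
      ring
    rw [← hK, this, mul_add]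
    have h2 : 0 ≤ K * (2 * ((1 / N : ℝ) * (1 / N) ^ outside γ.vertices δ)) := by positivity
    linarith

/-- A bound for the expected error when a circuit with `n` edges is switched in and circuits with `m`
edges are counted. -/
noncomputable def switchError (N n m : ℕ) : ℝ :=
  2 * (9 * (n + 2)) ^ m / N + (18 * N) ^ m * conditioningGap N n m

/-- Switching in a circuit `γ` changes the numbers of circuits by `1` for the class that `γ` carries,
and by `0` for all others, up to an error that is small in mean. -/
theorem sum_abs_Z_switch_le {γ : RootedCircuit N n} {S : Pairing N → Pairing N}
    (hS : ∀ g : Pairing N → ℝ,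
        ∑ ω, g (S ω) = pairingFactor N γ.edges.card * ∑ ω ∈ containing γ.edges, g ω)
    (hkeep : ∀ ω, ∀ e ∈ ω.1.parts, Disjoint e (γ.edges.biUnion id) → e ∈ (S ω).1.parts)
    (d : WordClass) (hN : n + d.length ≤ N) :
    ∑ ω, |(Z N d (S ω) : ℝ) - Z N d ω - if γ.edges ∈ circuitSets N d then 1 else 0| ≤
      Fintype.card (Pairing N) * switchError N n d.length := by
  have hn1 : 1 ≤ n := NeZero.one_le
  have hN0 : 0 < N := by omega
  have hN1 : (0 : ℝ) < N := by exact_mod_cast hN0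
  have hgap := conditioningGap_nonneg hN hN0
  have hpt : ∀ ω, |(Z N d (S ω) : ℝ) - Z N d ω - if γ.edges ∈ circuitSets N d then 1 else 0| ≤
      ∑ D ∈ circuitSets N d, |ind D (S ω) - ind D ω - if D = γ.edges then 1 else 0| := by
    intro ω
    have : (Z N d (S ω) : ℝ) - Z N d ω - (if γ.edges ∈ circuitSets N d then 1 else 0) =
        ∑ D ∈ circuitSets N d, (ind D (S ω) - ind D ω - if D = γ.edges then 1 else 0) := by
      rw [Finset.sum_sub_distrib, Finset.sum_sub_distrib, Finset.sum_ite_eq', Z_eq_sum, Z_eq_sum]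
      rfl
    rw [this]
    exact Finset.abs_sum_le_sum_abs _ _
  refine (Finset.sum_le_sum fun ω _ => hpt ω).trans ?_
  rw [Finset.sum_comm]
  refine (sum_circuitSets_le N d (F := fun D => ∑ ω, |ind D (S ω) - ind D ω -
    if D = γ.edges then 1 else 0|) fun D => Finset.sum_nonneg fun _ _ => abs_nonneg _).trans ?_
  refine (Finset.sum_le_sum fun δ _ => sum_abs_ind_switch_le hS hkeep hN δ).trans ?_
  rw [← Finset.mul_sum, Finset.sum_add_distrib, ← Finset.mul_sum, ← Finset.mul_sum,
    Finset.sum_const, card_univ, nsmul_eq_mul]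
  refine mul_le_mul_of_nonneg_left ?_ (Nat.cast_nonneg _)
  refine add_le_add ?_ (mul_le_mul_of_nonneg_right (RootedCircuit.card_le N _) hgap)
  have h := RootedCircuit.sum_pow_outside_le γ.vertices d.length (x := 1 / N) (by positivity)
  have h2 : (9 * ((γ.vertices.card : ℝ) + 2 * N * (1 / N))) ^ d.length ≤
      (9 * ((n : ℝ) + 2)) ^ d.length := by
    refine pow_le_pow_left₀ (by positivity) ?_ _
    have : (γ.vertices.card : ℝ) ≤ n := by exact_mod_cast γ.card_vertices_le
    rw [mul_one_div, mul_div_assoc, div_self hN1.ne']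
    linarith
  have h3 := mul_le_mul_of_nonneg_left (h.trans h2) (by positivity : (0 : ℝ) ≤ 2 * (1 / N))
  calc _ = 2 * (1 / N : ℝ) * ∑ δ : RootedCircuit N d.length,
        (1 / N : ℝ) ^ RootedCircuit.outside γ.vertices δ := by ring
    _ ≤ _ := h3
    _ = _ := by ring

end Estimates

/-! ### Asymptotics of the error and of the expected counts -/

section Asymptotics

open Finset

theorem tendsto_linear_div (b d c : ℝ) :
    Tendsto (fun N : ℕ => (b * N + d) / (6 * N - c)) atTop (𝓝 (b / 6)) := by
  have h1 : ∀ e : ℝ, Tendsto (fun N : ℕ => e / (N : ℝ)) atTop (𝓝 0) := fun e =>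
    tendsto_const_div_atTop_nhds_zero_nat e
  have h2 : Tendsto (fun N : ℕ => (b + d / (N : ℝ)) / (6 - c / (N : ℝ))) atTop
      (𝓝 ((b + 0) / (6 - 0))) :=
    ((h1 d).const_add b).div ((h1 c).const_sub 6) (by norm_num)
  rw [add_zero, sub_zero] at h2
  refine h2.congr' ?_
  filter_upwards [eventually_gt_atTop 0] with N hN
  have hN' : (N : ℝ) ≠ 0 := by exact_mod_cast hN.ne'
  rw [← mul_div_mul_right _ _ hN']
  congr 1 <;> field_simp

theorem tendsto_pow_div_prod (a m : ℕ) :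
    Tendsto (fun N : ℕ => (18 * N : ℝ) ^ m /
      ∏ j ∈ Finset.range m, (6 * N - 1 - 2 * (a + j) : ℝ)) atTop (𝓝 (3 ^ m)) := by
  have h : Tendsto (fun N : ℕ => ∏ j ∈ Finset.range m,
      ((18 * N + 0 : ℝ) / (6 * N - (1 + 2 * (a + j))))) atTop
      (𝓝 (∏ _j ∈ Finset.range m, (18 / 6 : ℝ))) :=
    tendsto_finsetProd _ fun j _ => tendsto_linear_div 18 0 (1 + 2 * (a + j))
  rw [Finset.prod_const, card_range] at h
  norm_num at h
  refine h.congr fun N => ?_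
  simp only [sub_add_eq_sub_sub]

theorem tendsto_switchError (n m : ℕ) :
    Tendsto (fun N => switchError N n m) atTop (𝓝 0) := by
  have h1 : Tendsto (fun N : ℕ => 2 * (9 * ((n : ℝ) + 2)) ^ m / (N : ℝ)) atTop (𝓝 0) :=
    tendsto_const_div_atTop_nhds_zero_nat _
  have h2 := (tendsto_pow_div_prod n m).sub (tendsto_pow_div_prod 0 m)
  rw [sub_self] at h2
  have h3 := h1.add h2
  rw [add_zero] at h3
  refine h3.congr' ?_
  filter_upwards [eventually_ge_atTop (n + 1)] with N hN
  have hQ := pairingFactor_pos (N := N) (k := n) (by omega) (by omega)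
  rw [switchError, conditioningGap, pairingFactor_add, div_mul_eq_div_div, div_self hQ.ne',
    mul_sub, mul_one_div, mul_one_div]
  simp [pairingFactor]

/-- The expected number of circuits that carry a class. -/
noncomputable def expectedCircuits (N : ℕ) (c : WordClass) : ℝ :=
  (circuitSets N c).card / pairingFactor N c.length

theorem tendsto_expectedCircuits (c : WordClass) :
    Tendsto (fun N => expectedCircuits N c) atTop (𝓝 (c.mean : ℝ)) := by
  have hn : (c.length : ℝ) ≠ 0 := by exact_mod_cast NeZero.ne c.length
  have h : Tendsto (fun N : ℕ => ∏ j ∈ Finset.range c.length,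
      ((6 * N + (-3 * j) : ℝ) / (6 * N - (1 + 2 * j)))) atTop
      (𝓝 (∏ _j ∈ Finset.range c.length, (6 / 6 : ℝ))) :=
    tendsto_finsetProd _ fun j _ => tendsto_linear_div 6 (-3 * j) (1 + 2 * j)
  rw [div_self (by norm_num), Finset.prod_const_one] at h
  have h2 := h.const_mul ((c.card : ℝ) / (2 * c.length))
  have hmean : (c.mean : ℝ) = (c.card : ℝ) / (2 * c.length) * 1 := by
    rw [WordClass.mean]
    push_cast
    ring
  rw [← hmean] at h2
  refine h2.congr' ?_
  filter_upwards [eventually_ge_atTop c.length] with N hN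
  have h3 := sum_circuitSets N c fun _ => 1
  simp only [Finset.sum_const, nsmul_eq_mul, mul_one] at h3
  have h4 : ((circuitSets N c).card : ℝ) = (rootedCircuits N c).card / (2 * c.length) := by
    rw [h3]
    field_simp
  have h5 : (((2 * N).descFactorial c.length * 3 ^ c.length : ℕ) : ℝ) =
      ∏ j ∈ Finset.range c.length, (6 * N + (-3 * j) : ℝ) := by
    rw [Nat.descFactorial_eq_prod_range]
    push_cast
    rw [← card_range c.length, ← Finset.prod_const, card_range, ← Finset.prod_mul_distrib]
    refine Finset.prod_congr rfl fun j hj => ?_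
    have := Finset.mem_range.mp hj
    rw [Nat.cast_sub (by omega)]
    push_cast
    ring
  rw [expectedCircuits, h4, card_rootedCircuits, Nat.cast_mul, h5, Finset.prod_div_distrib,
    pairingFactor]
  simp only [sub_add_eq_sub_sub]
  ring

end Asymptotics

/-! ### Convergence to independent Poisson variables -/

section Limit

variable {ι : Type*} [Fintype ι] [DecidableEq ι]

/-- If point weights of total mass at most `1` asymptotically satisfy a first-order recursion that
determines the probability weights `q`, and do not lose mass at infinity, then they converge to `q`. -/
theorem tendsto_of_recursion {p : ℕ → (ι → ℕ) → ℝ} {q : (ι → ℕ) → ℝ} {r : ι → ℝ}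
    (hp1 : ∀ N B, ∑ k ∈ B, p N k ≤ 1)
    (hp : ∀ N k, 0 ≤ p N k) (hq0 : 0 < q 0)
    (hq1 : ∀ B, ∑ k ∈ B, q k ≤ 1)
    (hqrec : ∀ k c, (k c + 1) * q (k + Pi.single c 1) = r c * q k)
    (hrec : ∀ k c, Tendsto (fun N => (k c + 1) * p N (k + Pi.single c 1) - r c * p N k)
      atTop (𝓝 0))
    (htight : ∀ ε > 0, ∃ B : Finset (ι → ℕ), 1 - ε ≤ ∑ k ∈ B, q k ∧
      ∀ᶠ N in atTop, 1 - ε ≤ ∑ k ∈ B, p N k) (k : ι → ℕ) :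
    Tendsto (fun N => p N k) atTop (𝓝 (q k)) := by
  -- By the recursion, `p N` is asymptotically the multiple `s N • q` of `q`. As neither of them loses
  -- mass at infinity, `s N` tends to `1`.
  set s : ℕ → ℝ := fun N => p N 0 / q 0 with hs
  have hs0 : ∀ N, 0 ≤ s N := fun N => div_nonneg (hp N 0) hq0.le
  have hdiff : ∀ n : ℕ, ∀ k : ι → ℕ, ∑ i, k i = n →
      Tendsto (fun N => p N k - s N * q k) atTop (𝓝 0) := by
    intro n
    induction n with
    | zero =>
      intro k hk
      have hk0 : k = 0 := by
        funext i
        exact Finset.sum_eq_zero_iff.mp hk i (Finset.mem_univ i)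
      subst hk0
      refine tendsto_const_nhds.congr fun N => ?_
      rw [hs, div_mul_cancel₀ _ hq0.ne', sub_self]
    | succ n ih =>
      intro k hk
      obtain ⟨c, -, hc⟩ := Finset.exists_ne_zero_of_sum_ne_zero (by rw [hk]; omega :
        ∑ i, k i ≠ 0)
      obtain ⟨l, rfl⟩ : ∃ l : ι → ℕ, k = l + Pi.single c 1 := by
        refine ⟨k - Pi.single c 1, funext fun i => ?_⟩
        by_cases h : i = c
        · subst h
          simp only [Pi.add_apply, Pi.sub_apply, Pi.single_eq_same]
          omega
        · simp [h]
      have hl : ∑ i, l i = n := by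
        simp only [Pi.add_apply, Finset.sum_add_distrib, Finset.sum_pi_single', Finset.mem_univ,
          if_true] at hk
        omega
      have h1 := ((hrec l c).add ((ih l hl).const_mul (r c))).div_const ((l c : ℝ) + 1)
      rw [mul_zero, add_zero, zero_div] at h1
      refine h1.congr fun N => ?_
      have hpos : (l c : ℝ) + 1 ≠ 0 := by positivity
      rw [div_eq_iff hpos]
      linear_combination s N * hqrec l c
  have hlim : Tendsto s atTop (𝓝 1) := by
    rw [Metric.tendsto_atTop']
    intro ε hε
    set η : ℝ := min (ε / 8) (1 / 4) with hη
    have hη0 : 0 < η := by positivity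
    have hη1 : η ≤ ε / 8 := min_le_left _ _
    have hη2 : η ≤ 1 / 4 := min_le_right _ _
    obtain ⟨B, hB, hBp⟩ := htight η hη0
    have hBlim : Tendsto (fun N => ∑ k ∈ B, (p N k - s N * q k)) atTop (𝓝 0) := by
      have := tendsto_finsetSum B fun k _ => hdiff _ k rfl
      simpa using this
    have hclose := (Metric.tendsto_nhds.mp hBlim) η hη0
    obtain ⟨M, hM⟩ := eventually_atTop.mp (hBp.and hclose)
    refine ⟨M, fun N hN => ?_⟩
    obtain ⟨h1, h2⟩ := hM N hN.le
    rw [Real.dist_eq, sub_zero, Finset.sum_sub_distrib, ← Finset.mul_sum, abs_lt] at h2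
    have h3 := hp1 N B
    have h4 := hq1 B
    have h5 := hs0 N
    have hlow : 1 - 2 * η ≤ s N := by nlinarith
    have hup : s N ≤ 1 + 4 * η := by
      by_contra hcon
      rw [not_le] at hcon
      nlinarith
    rw [Real.dist_eq, abs_lt]
    constructor <;> linarith
  have h := (hdiff _ k rfl).add (hlim.mul_const (q k))
  rw [zero_add, one_mul] at h
  exact h.congr fun N => by ring

variable {E : Type*} [MeasurableSpace E] [MeasurableSingletonClass E]

/-- For a finite set `B`, the distance of two probability measures is controlled by their values on
the points of `B` and by the mass that one of them has outside of `B`. -/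
theorem abs_measureReal_sub_le (μ ν : Measure E)
    [IsProbabilityMeasure μ] [IsProbabilityMeasure ν] (B : Finset E) (A : Set E) :
    |μ.real A - ν.real A| ≤
      2 * ∑ k ∈ B, |μ.real {k} - ν.real {k}| + 2 * (1 - ∑ k ∈ B, ν.real {k}) := by
  classical
  have hsplit : ∀ (ρ : Measure E) [IsProbabilityMeasure ρ],
      ρ.real A = ∑ k ∈ B.filter (· ∈ A), ρ.real {k} + ρ.real (A \ B) ∧
      0 ≤ ρ.real (A \ B) ∧ ρ.real (A \ B) ≤ 1 - ∑ k ∈ B, ρ.real {k} := by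
    intro ρ _
    refine ⟨?_, measureReal_nonneg, ?_⟩
    · rw [sum_measureReal_singleton, ← measureReal_inter_add_sdiff (s := A) B.measurableSet]
      congr 2
      ext x
      simp [and_comm]
    · rw [sum_measureReal_singleton, ← probReal_compl_eq_one_sub B.measurableSet]
      exact measureReal_mono fun x hx => hx.2
  obtain ⟨hμ1, hμ2, hμ3⟩ := hsplit μ
  obtain ⟨hν1, hν2, hν3⟩ := hsplit ν
  have h1 : |∑ k ∈ B.filter (· ∈ A), μ.real {k} - ∑ k ∈ B.filter (· ∈ A), ν.real {k}| ≤
      ∑ k ∈ B, |μ.real {k} - ν.real {k}| := by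
    rw [← Finset.sum_sub_distrib]
    exact (Finset.abs_sum_le_sum_abs _ _).trans
      (Finset.sum_le_sum_of_subset_of_nonneg (Finset.filter_subset _ _) fun _ _ _ => abs_nonneg _)
  have h2 : |∑ k ∈ B, μ.real {k} - ∑ k ∈ B, ν.real {k}| ≤
      ∑ k ∈ B, |μ.real {k} - ν.real {k}| := by
    rw [← Finset.sum_sub_distrib]
    exact Finset.abs_sum_le_sum_abs _ _
  rw [hμ1, hν1]
  rw [abs_le] at h1 h2 ⊢
  constructor <;> linarith

end Limit

section Convergence

noncomputable local instance : DecidableEq WordClass := Classical.decEq _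

/-! ### The recursion for the circuit counts -/

section Recursion

open Finset

variable {N : ℕ}

/-- The circuit counts for the classes in `W`. -/
noncomputable def counts (W : Finset WordClass) (ω : Pairing N) (w : W) : ℕ := Z N w ω

/-- The probability of a value of the vector of circuit counts. -/
noncomputable def countProb (W : Finset WordClass) (N : ℕ) (k : W → ℕ) : ℝ :=
  (∑ ω : Pairing N, if counts W ω = k then 1 else 0) / Fintype.card (Pairing N)

theorem card_pairing_pos (N : ℕ) : (0 : ℝ) < Fintype.card (Pairing N) := by
  exact_mod_cast Fintype.card_pos

theorem sum_Z_mul (c : WordClass) (g : Pairing N → ℝ) :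
    ∑ ω, (Z N c ω : ℝ) * g ω = ∑ C ∈ circuitSets N c, ∑ ω ∈ containing C, g ω := by
  simp only [Z_eq_sum, Finset.sum_mul, ite_mul, one_mul, zero_mul]
  rw [Finset.sum_comm]
  refine Finset.sum_congr rfl fun C _ => ?_
  rw [containing, Finset.sum_filter]

/-- The mean of the number of circuits carrying a class. -/
theorem sum_Z_eq (c : WordClass) :
    ∑ ω : Pairing N, (Z N c ω : ℝ) = Fintype.card (Pairing N) * expectedCircuits N c := by
  have h := sum_Z_mul (N := N) c fun _ => 1
  simp only [mul_one, Finset.sum_const, nsmul_eq_mul] at h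
  rw [h, expectedCircuits]
  have : ∀ C ∈ circuitSets N c, ((containing C).card : ℝ) =
      Fintype.card (Pairing N) / pairingFactor N c.length := by
    intro C hC
    obtain ⟨γ, -, rfl⟩ := Finset.mem_image.mp hC
    rw [card_containing_eq γ.isPartialPairing_edges, γ.card_edges]
  rw [Finset.sum_congr rfl this, Finset.sum_const, nsmul_eq_mul]
  ring

/-- The recursion `(kᵢ + 1) P(Z = k + eᵢ) = λᵢ P(Z = k)`, which characterizes independent Poisson
variables, holds approximately for the circuit counts. -/
theorem abs_recursion_le (W : Finset WordClass) (k : W → ℕ) (c : W)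
    (hN : ∀ d : W, c.1.length + d.1.length ≤ N) :
    |(k c + 1) * countProb W N (k + Pi.single c 1) -
        expectedCircuits N c * countProb W N k| ≤
      expectedCircuits N c * ∑ d : W, switchError N c.1.length d.1.length := by
  have hK := card_pairing_pos N
  have hn1 : 1 ≤ c.1.length := NeZero.one_le
  have hQ := pairingFactor_pos (N := N) (k := c.1.length) (by have := hN c; omega)
    (by have := hN c; omega)
  set K : ℝ := (Fintype.card (Pairing N) : ℝ)
  set Q := pairingFactor N c.1.length
  let f : (W → ℕ) → Pairing N → ℝ := fun l ω => if counts W ω = l then 1 else 0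
  have hlhs : (k c + 1) * ∑ ω, f (k + Pi.single c 1) ω =
      ∑ C ∈ circuitSets N c, ∑ ω ∈ containing C, f (k + Pi.single c 1) ω := by
    rw [← sum_Z_mul, Finset.mul_sum]
    refine Finset.sum_congr rfl fun ω _ => ?_
    simp only [f]
    split_ifs with h
    · have := congrFun h c
      simp only [counts, Pi.add_apply, Pi.single_eq_same] at this
      rw [this]
      push_cast
      ring
    · simp
  have hC : ∀ C ∈ circuitSets N c,
      |∑ ω ∈ containing C, f (k + Pi.single c 1) ω - (∑ ω, f k ω) / Q| ≤
        K * (∑ d : W, switchError N c.1.length d.1.length) / Q := by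
    intro C hC
    have hCmem := hC
    obtain ⟨γ, -, rfl⟩ := Finset.mem_image.mp hC
    obtain ⟨S, hS, hkeep⟩ := exists_switching γ.isPartialPairing_edges
    have h1 : ∑ ω ∈ containing γ.edges, f (k + Pi.single c 1) ω =
        (∑ ω, f (k + Pi.single c 1) (S ω)) / Q := by
      rw [hS, γ.card_edges, mul_div_cancel_left₀ _ hQ.ne']
    rw [h1, ← sub_div, abs_div, abs_of_pos hQ]
    refine div_le_div_of_nonneg_right ?_ hQ.le
    rw [← Finset.sum_sub_distrib, Finset.mul_sum]
    refine (Finset.abs_sum_le_sum_abs _ _).trans ?_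
    refine le_trans ?_ (Finset.sum_le_sum fun (d : W) _ =>
      sum_abs_Z_switch_le hS hkeep d.1 (hN d))
    rw [Finset.sum_comm]
    refine Finset.sum_le_sum fun ω _ => ?_
    have hone : ∀ d : W, (if γ.edges ∈ circuitSets N d.1 then (1 : ℝ) else 0) =
        ((Pi.single c 1 : W → ℕ) d : ℕ) := by
      intro d
      by_cases h : d = c
      · subst h
        rw [if_pos hCmem, Pi.single_eq_same, Nat.cast_one]
      · rw [if_neg fun h2 => h (Subtype.ext (eq_of_mem_circuitSets h2 hCmem)),
          Pi.single_eq_of_ne h, Nat.cast_zero]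
    simp only [hone]
    by_cases hall : counts W (S ω) = counts W ω + Pi.single c 1
    · have : f (k + Pi.single c 1) (S ω) = f k ω := by
        simp only [f, hall, add_left_inj]
      rw [this, sub_self, abs_zero]
      exact Finset.sum_nonneg fun _ _ => abs_nonneg _
    · obtain ⟨d, hd⟩ := Function.ne_iff.mp hall
      have hf : |f (k + Pi.single c 1) (S ω) - f k ω| ≤ 1 := by
        simp only [f]
        split_ifs <;> norm_num
      refine hf.trans (le_trans ?_ (Finset.single_le_sum (f := fun d : W =>
        |(Z N d.1 (S ω) : ℝ) - Z N d.1 ω - ((Pi.single c 1 : W → ℕ) d : ℕ)|)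
        (fun _ _ => abs_nonneg _) (mem_univ d)))
      -- The counts are integers, so a coordinate that is off is off by at least `1`.
      have hz : ((Z N d.1 (S ω) : ℤ) - Z N d.1 ω - ((Pi.single c 1 : W → ℕ) d : ℕ)) ≠ 0 := by
        intro h0
        apply hd
        simp only [counts, Pi.add_apply]
        omega
      have := Int.one_le_abs hz
      exact_mod_cast this
  have hsum : |(k c + 1) * ∑ ω, f (k + Pi.single c 1) ω -
      (circuitSets N c).card * ((∑ ω, f k ω) / Q)| ≤
      (circuitSets N c).card * (K * (∑ d : W, switchError N c.1.length d.1.length) / Q) := by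
    rw [hlhs, ← nsmul_eq_mul, ← Finset.sum_const, ← Finset.sum_sub_distrib, ← nsmul_eq_mul,
      ← Finset.sum_const]
    exact (Finset.abs_sum_le_sum_abs _ _).trans (Finset.sum_le_sum hC)
  have hdiv := div_le_div_of_nonneg_right hsum hK.le
  rw [← abs_of_pos hK, ← abs_div, abs_of_pos hK] at hdiv
  convert! hdiv using 1
  · congr 1
    simp only [countProb, expectedCircuits, f]
    ring
  · rw [show expectedCircuits N c = (circuitSets N c).card / Q from rfl]
    field_simp

theorem countProb_nonneg (W : Finset WordClass) (N : ℕ) (k : W → ℕ) : 0 ≤ countProb W N k :=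
  div_nonneg (Finset.sum_nonneg fun _ _ => by split_ifs <;> norm_num) (Nat.cast_nonneg _)

theorem sum_countProb (W : Finset WordClass) (N : ℕ) (B : Finset (W → ℕ)) :
    ∑ k ∈ B, countProb W N k =
      (∑ ω : Pairing N, if counts W ω ∈ B then 1 else 0) / Fintype.card (Pairing N) := by
  simp only [countProb]
  rw [← Finset.sum_div, Finset.sum_comm]
  simp only [Finset.sum_ite_eq]

theorem sum_countProb_le_one (W : Finset WordClass) (N : ℕ) (B : Finset (W → ℕ)) :
    ∑ k ∈ B, countProb W N k ≤ 1 := by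
  rw [sum_countProb, div_le_one (card_pairing_pos N)]
  refine (Finset.sum_le_sum fun ω _ => (?_ : _ ≤ (1 : ℝ))).trans ?_
  · split_ifs <;> norm_num
  · simp

/-- Markov's inequality: if the counts leave the box `[0, M]^W`, then their sum is at least
`M + 1`. -/
theorem one_sub_le_sum_countProb (W : Finset WordClass) (N M : ℕ) :
    1 - (∑ c : W, expectedCircuits N c) / (M + 1) ≤
      ∑ k ∈ Finset.Iic (fun _ : W => M), countProb W N k := by
  have hK := card_pairing_pos N
  have hM : (0 : ℝ) < M + 1 := by positivity
  rw [sum_countProb, le_div_iff₀ hK]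
  have hpt : ∀ ω : Pairing N, (1 : ℝ) - (∑ c : W, (Z N c ω : ℝ)) / (M + 1) ≤
      if counts W ω ∈ Finset.Iic (fun _ : W => M) then 1 else 0 := by
    intro ω
    have h0 : 0 ≤ (∑ c : W, (Z N c ω : ℝ)) / (M + 1) :=
      div_nonneg (Finset.sum_nonneg fun _ _ => Nat.cast_nonneg _) hM.le
    by_cases h : counts W ω ∈ Finset.Iic (fun _ : W => M)
    · rw [if_pos h]
      exact sub_le_self _ h0
    · rw [if_neg h]
      rw [Finset.mem_Iic, Pi.le_def, not_forall] at h
      obtain ⟨d, hd⟩ := h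
      rw [sub_nonpos, one_le_div hM]
      have h1 : M + 1 ≤ Z N d ω := not_le.mp hd
      have h2 : (M : ℝ) + 1 ≤ Z N d ω := by exact_mod_cast h1
      exact h2.trans (Finset.single_le_sum (f := fun c : W => (Z N c ω : ℝ))
        (fun _ _ => Nat.cast_nonneg _) (mem_univ d))
  have hsum := Finset.sum_le_sum fun ω (_ : ω ∈ univ) => hpt ω
  refine le_trans (le_of_eq ?_) hsum
  rw [Finset.sum_sub_distrib, ← Finset.sum_div, Finset.sum_comm]
  simp only [sum_Z_eq]
  rw [← Finset.mul_sum]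
  simp only [Finset.sum_const, card_univ, nsmul_eq_mul]
  ring

theorem tendsto_recursion (W : Finset WordClass) (k : W → ℕ) (c : W) :
    Tendsto (fun N => (k c + 1) * countProb W N (k + Pi.single c 1) -
      (c.1.mean : ℝ) * countProb W N k) atTop (𝓝 0) := by
  have ha := tendsto_expectedCircuits c.1
  have herr : Tendsto (fun N => ∑ d : W, switchError N c.1.length d.1.length) atTop (𝓝 0) := by
    have := tendsto_finsetSum (univ : Finset W) fun d _ => tendsto_switchError c.1.length d.1.length
    simpa using this
  have hbound : Tendsto (fun N => expectedCircuits N c *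
      (∑ d : W, switchError N c.1.length d.1.length) + |expectedCircuits N c - c.1.mean|)
      atTop (𝓝 0) := by
    have h := (ha.mul herr).add (ha.sub_const (c.1.mean : ℝ)).abs
    simpa using h
  refine squeeze_zero_norm' ?_ hbound
  filter_upwards [eventually_ge_atTop (c.1.length + ∑ d : W, d.1.length)] with N hN
  have h1 := abs_recursion_le W k c (N := N) fun d =>
    le_trans (Nat.add_le_add_left (Finset.single_le_sum (f := fun d : W => d.1.length)
      (fun _ _ => Nat.zero_le _) (mem_univ d)) _) hN
  have h2 : |(expectedCircuits N c - c.1.mean) * countProb W N k| ≤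
      |expectedCircuits N c - c.1.mean| := by
    rw [abs_mul, abs_of_nonneg (countProb_nonneg W N k)]
    refine mul_le_of_le_one_right (abs_nonneg _) ?_
    simpa using sum_countProb_le_one W N {k}
  rw [Real.norm_eq_abs]
  refine le_trans (le_of_eq ?_) ((abs_add_le _ _).trans (add_le_add h1 h2))
  congr 1
  ring

end Recursion

/-! ### The limit law -/

section Law

/-- The law of independent Poisson variables with the given means. -/
noncomputable def poissonProduct (W : Finset WordClass) : Measure (W → ℕ) :=
  Measure.pi fun w : W => poissonMeasure w.1.mean

instance (W : Finset WordClass) : IsProbabilityMeasure (poissonProduct W) := by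
  unfold poissonProduct
  infer_instance

theorem poissonProduct_real_singleton (W : Finset WordClass) (k : W → ℕ) :
    (poissonProduct W).real {k} =
      ∏ w : W, Real.exp (-w.1.mean) * (w.1.mean : ℝ) ^ k w / (k w).factorial := by
  rw [poissonProduct, measureReal_def, Measure.pi_singleton, ENNReal.toReal_prod]
  refine Finset.prod_congr rfl fun w _ => ?_
  rw [← measureReal_def, poissonMeasure_real_singleton]

theorem poissonProduct_recursion (W : Finset WordClass) (k : W → ℕ) (c : W) :
    (k c + 1) * (poissonProduct W).real {k + Pi.single c 1} =
      c.1.mean * (poissonProduct W).real {k} := by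
  rw [poissonProduct_real_singleton, poissonProduct_real_singleton,
    Fintype.prod_eq_mul_prod_compl c, Fintype.prod_eq_mul_prod_compl c]
  have h : ∀ w ∈ ({c} : Finset W)ᶜ, (k + Pi.single c 1 : W → ℕ) w = k w := by
    intro w hw
    have : w ≠ c := by simpa using hw
    simp [this]
  rw [Finset.prod_congr rfl fun w hw => by rw [h w hw]]
  simp only [Pi.add_apply, Pi.single_eq_same, Nat.factorial_succ, Nat.cast_mul, pow_succ]
  have h1 : ((k c + 1 : ℕ) : ℝ) ≠ 0 := by positivity
  have h2 : ((k c).factorial : ℝ) ≠ 0 := by positivity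
  push_cast at h1 ⊢
  field_simp

theorem measureReal_map_counts (W : Finset WordClass) (N : ℕ) (k : W → ℕ) :
    ((uniform N).map (counts W)).real {k} = countProb W N k := by
  rw [map_measureReal_apply (measurable_of_countable _) (measurableSet_singleton k), countProb,
    measureReal_def, uniform, uniformOn_univ]
  have h : (counts W ⁻¹' {k} : Set (Pairing N)) =
      ((Finset.univ.filter fun ω : Pairing N => counts W ω = k : Finset (Pairing N)) :
        Set (Pairing N)) := by
    ext ω
    simp
  rw [h, Measure.count_apply_finset, ENNReal.toReal_div, Finset.sum_boole]
  simp only [ENNReal.toReal_natCast]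

theorem tendsto_poissonProduct_Iic (W : Finset WordClass) :
    Tendsto (fun M : ℕ => ∑ k ∈ Finset.Iic (fun _ : W => M), (poissonProduct W).real {k})
      atTop (𝓝 1) := by
  have hmono : Monotone fun M : ℕ =>
      ((Finset.Iic fun _ : W => M : Finset (W → ℕ)) : Set (W → ℕ)) := by
    intro M M' h k hk
    simp only [Finset.coe_Iic, Set.mem_Iic] at hk ⊢
    exact hk.trans fun _ => h
  have hU : ⋃ M : ℕ, ((Finset.Iic fun _ : W => M : Finset (W → ℕ)) : Set (W → ℕ)) = Set.univ := by
    refine Set.eq_univ_of_forall fun k => Set.mem_iUnion.mpr ⟨∑ w, k w, ?_⟩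
    simp only [Finset.coe_Iic, Set.mem_Iic]
    exact fun w => Finset.single_le_sum (f := k) (fun _ _ => Nat.zero_le _) (Finset.mem_univ w)
  have h := tendsto_measure_iUnion_atTop (μ := poissonProduct W) hmono
  rw [hU, measure_univ] at h
  have h2 := (ENNReal.tendsto_toReal ENNReal.one_ne_top).comp h
  simp only [ENNReal.toReal_one] at h2
  refine h2.congr fun M => ?_
  rw [sum_measureReal_singleton]
  rfl

theorem tendsto_countProb (W : Finset WordClass) (k : W → ℕ) :
    Tendsto (fun N => countProb W N k) atTop (𝓝 ((poissonProduct W).real {k})) := by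
  refine tendsto_of_recursion (q := fun k => (poissonProduct W).real {k})
    (r := fun c : W => (c.1.mean : ℝ)) (fun N B => sum_countProb_le_one W N B)
    (countProb_nonneg W) ?_ ?_ (poissonProduct_recursion W) (tendsto_recursion W) ?_ k
  · simp only [poissonProduct_real_singleton, Pi.zero_apply, pow_zero, Nat.factorial_zero]
    exact Finset.prod_pos fun w _ => by positivity
  · intro B
    rw [sum_measureReal_singleton]
    exact measureReal_le_one
  · intro ε hε
    have hE : Tendsto (fun N => ∑ c : W, expectedCircuits N c) atTop
        (𝓝 (∑ c : W, (c.1.mean : ℝ))) :=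
      tendsto_finsetSum _ fun c _ => tendsto_expectedCircuits c.1
    set T : ℝ := ∑ c : W, (c.1.mean : ℝ) with hT
    have h1 : ∀ᶠ M : ℕ in atTop, 1 - ε < ∑ k ∈ Finset.Iic (fun _ : W => M),
        (poissonProduct W).real {k} :=
      (tendsto_poissonProduct_Iic W).eventually_const_lt (by linarith)
    have h2 : ∀ᶠ M : ℕ in atTop, (T + 1) / (M + 1) < ε :=
      (tendsto_const_div_atTop_nhds_zero_nat (T + 1)).comp (tendsto_add_atTop_nat 1)
        |>.eventually_lt_const hε |>.mono fun M hM => by simpa using hM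
    obtain ⟨M, hM1, hM2⟩ := (h1.and h2).exists
    refine ⟨_, hM1.le, ?_⟩
    filter_upwards [hE.eventually_lt_const (lt_add_one T)] with N hN
    have h3 := one_sub_le_sum_countProb W N M
    have h4 : (∑ c : W, expectedCircuits N c) / (M + 1 : ℝ) ≤ (T + 1) / (M + 1) :=
      div_le_div_of_nonneg_right hN.le (by positivity)
    linarith

/-- Convergence of the laws, uniformly over all events. -/
theorem eventually_abs_law_sub_le (W : Finset WordClass) {ε : ℝ} (hε : 0 < ε) :
    ∀ᶠ N in atTop, ∀ A : Set (W → ℕ),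
      |((uniform N).map (counts W)).real A - (poissonProduct W).real A| ≤ ε := by
  obtain ⟨M, hM⟩ := ((tendsto_poissonProduct_Iic W).eventually_const_lt
    (by linarith : 1 - ε / 4 < 1)).exists
  have h : Tendsto (fun N => ∑ k ∈ Finset.Iic (fun _ : W => M),
      |countProb W N k - (poissonProduct W).real {k}|) atTop (𝓝 0) := by
    have := tendsto_finsetSum (Finset.Iic (fun _ : W => M)) fun k _ =>
      ((tendsto_countProb W k).sub_const ((poissonProduct W).real {k})).abs
    simpa using this
  filter_upwards [h.eventually_lt_const (by positivity : 0 < ε / 4)] with N hN A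
  have : IsProbabilityMeasure ((uniform N).map (counts W)) :=
    Measure.isProbabilityMeasure_map (measurable_of_countable _).aemeasurable
  have h2 := abs_measureReal_sub_le ((uniform N).map (counts W)) (poissonProduct W)
    (Finset.Iic (fun _ : W => M)) A
  simp only [measureReal_map_counts] at h2
  linarith

theorem tendsto_supDist (W : Finset WordClass) :
    Tendsto (fun N : ℕ => supDist (uniform N) (poissonProduct W)
      (fun (ω : Pairing N) (w : W) => Z N w ω) (fun x w => x w)) atTop (𝓝 0) := by
  rw [Metric.tendsto_nhds]
  intro ε hε
  filter_upwards [eventually_abs_law_sub_le W (half_pos hε)] with N hN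
  have h0 : ∀ A : Set (W → ℕ), |(uniform N).real
      ((fun (ω : Pairing N) (w : W) => Z N w ω) ⁻¹' A) -
      (poissonProduct W).real ((fun (x : W → ℕ) w => x w) ⁻¹' A)| ≤ ε / 2 := by
    intro A
    have := hN A
    rwa [map_measureReal_apply (measurable_of_countable _) A.to_countable.measurableSet] at this
  have h1 : supDist (uniform N) (poissonProduct W)
      (fun (ω : Pairing N) (w : W) => Z N w ω) (fun x w => x w) ≤ ε / 2 :=
    ciSup_le h0
  have h2 : 0 ≤ supDist (uniform N) (poissonProduct W)
      (fun (ω : Pairing N) (w : W) => Z N w ω) (fun x w => x w) :=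
    Real.iSup_nonneg fun _ => abs_nonneg _
  rw [Real.dist_eq, sub_zero, abs_of_nonneg h2]
  linarith

end Law

end Convergence

end RandomRibbon

theorem theoremB (W : Finset RandomRibbon.WordClass) :
    ∃ (Ω : Type) (_ : MeasurableSpace Ω) (P : Measure Ω) (_ : IsProbabilityMeasure P)
      (Z : W → Ω → ℕ),
      (∀ w : W, HasLaw (Z w) (poissonMeasure (RandomRibbon.WordClass.mean w)) P) ∧
      iIndepFun Z P ∧
      TendstoInDistribution
        (fun (N : ℕ) (ω : RandomRibbon.Pairing N) (w : W) => RandomRibbon.Z N w ω)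
        atTop (fun (x : Ω) (w : W) => Z w x) RandomRibbon.uniform P ∧
      Tendsto
        (fun N : ℕ => RandomRibbon.supDist (RandomRibbon.uniform N) P
          (fun (ω : RandomRibbon.Pairing N) (w : W) => RandomRibbon.Z N w ω)
          (fun (x : Ω) (w : W) => Z w x))
        atTop (𝓝 0) := by
  refine ⟨W → ℕ, inferInstance, RandomRibbon.poissonProduct W, inferInstance, fun w x => x w,
    fun w => ⟨(measurable_pi_apply w).aemeasurable, (measurePreserving_eval _ w).map_eq⟩,
    iIndepFun_pi (X := fun _ => id) fun _ => aemeasurable_id, ?_, RandomRibbon.tendsto_supDist W⟩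
  refine ⟨fun N => (measurable_of_countable _).aemeasurable,
    (measurable_of_countable _).aemeasurable, ?_⟩
  -- The measures of all sets converge, in particular those of open sets.
  refine tendsto_of_forall_isOpen_le_liminf_nat' fun G _ => (Tendsto.liminf_eq ?_).ge
  have hmap : (RandomRibbon.poissonProduct W).map (fun (x : W → ℕ) (w : W) => x w) =
      RandomRibbon.poissonProduct W := Measure.map_id
  change Tendsto (fun N => ((RandomRibbon.uniform N).map (RandomRibbon.counts W)) G) atTop
    (𝓝 (((RandomRibbon.poissonProduct W).map (fun (x : W → ℕ) (w : W) => x w)) G))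
  rw [hmap]
  have hfin : ∀ N, ((RandomRibbon.uniform N).map (RandomRibbon.counts W)) G ≠ ⊤ := fun N =>
    measure_ne_top _ _
  rw [← ENNReal.tendsto_toReal_iff hfin (measure_ne_top _ _), Metric.tendsto_nhds]
  intro ε hε
  filter_upwards [RandomRibbon.eventually_abs_law_sub_le W (half_pos hε)] with N hN
  exact lt_of_le_of_lt (hN G) (half_lt_self hε)
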